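/- For $m,n\in\mathbb N$ and $f\in[0,\tfrac12]$ let $A\in\{0,1\}^{m\times n}$ be a random matrix with i.i.d. Bernoulli($f$) entries, let $b\in\{0,1\}^m$ be uniform and independent of $A$, and let $h(x)=Ax+b \bmod 2$ for $x\in\{0,1\}^n$ (a random $f$-sparse hash function, $h\in_R\mathcal H^f_{m\times n}$). For $S\subseteq\{0,1\}^n$ put $S(h)=|\{x\in S: h(x)=0\}|$; the family $\mathcal H^f_{m\times n}$ $\epsilon$-shatters $S$ if $\Pr[S(h)\ge 1]\ge \tfrac12+\epsilon$. The minimum constraint density $\tilde f_\epsilon(m,n)$ is the smallest $f\in[0,\tfrac12]$ such that for every integer $c\ge 2$ the family $\mathcal H^f_{m\times n}$ $\epsilon$-shatters every set $S\subseteq\{0,1\}^n$ of size $2^{m+c}$, with $\tilde f_\epsilon(m,n)=+\infty$ if no such $f$ exists. Let $\log$ be the natural logarithm. 1. For every $\kappa>1$ there is $M_\kappa$ such that for all $\epsilon>0$, all $m\ge M_\kappa$ and all $n\ge m+2$, $$\tilde f_\epsilon(m,n)>\frac{\log m}{\kappa\,m}.$$ 2. Let $\epsilon\in(0,\tfrac3{10})$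 and $\alpha\in(0,1)$. There is $N$ such that for all $n\ge N$ and all integers $m\ge 0$ with $|m-\alpha n|<1$ (that is, $m=\alpha n$ up to rounding), $$\tilde f_\epsilon(m,n)\le\Bigl(3.6-\tfrac54\log_2\alpha\Bigr)\frac{\log m}{m}.$$ 3. Let $\epsilon\in(0,\tfrac3{10})$, $\alpha>0$, $\beta\in(0,1)$ and $\kappa>1$. There is $N$ such that for all $n\ge N$ and all integers $m\ge 0$ with $|m-\alpha n^\beta|<1$ (that is, $m=\alpha n^\beta$ up to rounding), $$\tilde f_\epsilon(m,n)\le\frac{\kappa(1-\beta)}{2\beta}\,\frac{\log^2 m}{m}.$$ -/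

import Mathlib

open scoped Matrix BigOperators

namespace SparseHash

/-- The point mass that the law of `A ∈ {0,1}^{m × n}` with i.i.d. Bernoulli(`f`) entries and
`b ∈ {0,1}^m` uniform and independent of `A` gives to a pair `(A, b)`. -/
noncomputable def weight {m n : ℕ} (f : ℝ) (A : Matrix (Fin m) (Fin n) (ZMod 2))
    (_b : Fin m → ZMod 2) : ℝ :=
  (∏ i, ∏ j, if A i j = 1 then f else 1 - f) * (1 / 2 : ℝ) ^ m

open Classical in
/-- The probability of an event under the random choice of the `f`-sparse hash function
`h_{A,b}`. -/
noncomputable def prob {m n : ℕ} (f : ℝ)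
    (E : Matrix (Fin m) (Fin n) (ZMod 2) → (Fin m → ZMod 2) → Prop) : ℝ :=
  ∑ A : Matrix (Fin m) (Fin n) (ZMod 2), ∑ b : Fin m → ZMod 2,
    if E A b then weight f A b else 0

/-- The hash function `h_{A,b}(x) = A x + b mod 2`. -/
def hash {m n : ℕ} (A : Matrix (Fin m) (Fin n) (ZMod 2)) (b : Fin m → ZMod 2)
    (x : Fin n → ZMod 2) : Fin m → ZMod 2 :=
  A *ᵥ x + b

/-- `S(h) = |{x ∈ S : h(x) = 0}|`. -/
def survivors {m n : ℕ} (S : Finset (Fin n → ZMod 2))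
    (A : Matrix (Fin m) (Fin n) (ZMod 2)) (b : Fin m → ZMod 2) : ℕ :=
  (S.filter fun x => hash A b x = 0).card

/-- The family of `f`-sparse hash functions `{0,1}^n → {0,1}^m` `ε`-shatters `S`. -/
def Shatters (ε : ℝ) (m n : ℕ) (f : ℝ) (S : Finset (Fin n → ZMod 2)) : Prop :=
  1 / 2 + ε ≤ prob (m := m) f (fun A b => 1 ≤ survivors S A b)

/-- The densities `f ∈ [0, 1/2]` for which, for every `c ≥ 2`, all sets `S ⊆ {0,1}^n` of size
`2^(m+c)` are `ε`-shattered. -/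
def admissible (ε : ℝ) (m n : ℕ) : Set ℝ :=
  {f | 0 ≤ f ∧ f ≤ 1 / 2 ∧ ∀ c : ℕ, 2 ≤ c → ∀ S : Finset (Fin n → ZMod 2),
    S.card = 2 ^ (m + c) → Shatters ε m n f S}

/-- The minimum constraint density. It is the least admissible density, and `⊤` if no density
in `[0, 1/2]` is admissible. -/
noncomputable def minDensity (ε : ℝ) (m n : ℕ) : EReal :=
  sInf ((fun f : ℝ => (f : EReal)) '' admissible ε m n)

/-- The point masses add up to one. -/
theorem prob_true {m n : ℕ} (f : ℝ) :
    prob (m := m) (n := n) f (fun _ _ => True) = 1 := by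
  have h1 : ∑ A : Matrix (Fin m) (Fin n) (ZMod 2),
      ∏ i, ∏ j, (if A i j = 1 then f else 1 - f) = 1 := by
    have h2 : ∀ i : Fin m, ∑ r : Fin n → ZMod 2,
        ∏ j, (if r j = 1 then f else 1 - f) = 1 := by
      intro i
      rw [← Fintype.prod_sum (fun (_ : Fin n) (a : ZMod 2) => if a = 1 then f else 1 - f)]
      apply Finset.prod_eq_one
      intro j _
      rw [show (Finset.univ : Finset (ZMod 2)) = {0, 1} from rfl]
      simp
    have h3 := Fintype.prod_sum
      (fun (_ : Fin m) (r : Fin n → ZMod 2) => ∏ j, (if r j = 1 then f else 1 - f))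
    rw [Finset.prod_congr rfl (fun i _ => h2 i), Finset.prod_const_one] at h3
    exact h3.symm
  have h4 : ((2 : ℝ) ^ m) * (1 / 2) ^ m = 1 := by
    rw [← mul_pow]; norm_num
  simp only [prob, weight, if_true, Finset.sum_const, Finset.card_univ, Fintype.card_fun,
    ZMod.card, Fintype.card_fin, nsmul_eq_mul, Nat.cast_pow, Nat.cast_ofNat]
  rw [← Finset.mul_sum, ← Finset.sum_mul, h1, one_mul, h4]

/-- If some density is admissible, the infimum defining `minDensity` is a minimum. -/
theorem exists_isLeast_admissible {ε : ℝ} {m n : ℕ} (h : (admissible ε m n).Nonempty) :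
    ∃ f : ℝ, IsLeast (admissible ε m n) f ∧ minDensity ε m n = (f : EReal) := by
  have hcont : ∀ S : Finset (Fin n → ZMod 2),
      Continuous fun f : ℝ => prob (m := m) f (fun A b => 1 ≤ survivors S A b) := by
    intro S
    unfold prob weight
    refine continuous_finsetSum _ fun A _ => continuous_finsetSum _ fun b _ => ?_
    split_ifs
    · refine Continuous.mul (continuous_finsetProd _ fun i _ =>
        continuous_finsetProd _ fun j _ => ?_) continuous_const
      split_ifs <;> fun_prop
    · exact continuous_const
  have hclosed : IsClosed (admissible ε m n) := by
    have he : admissible ε m n = Set.Icc (0 : ℝ) (1 / 2) ∩ ⋂ (c : ℕ) (_ : 2 ≤ c)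
        (S : Finset (Fin n → ZMod 2)) (_ : S.card = 2 ^ (m + c)),
        {f : ℝ | Shatters ε m n f S} := by
      ext f
      simp only [admissible, Set.mem_ofPred_eq, Set.mem_inter_iff, Set.mem_Icc, Set.mem_iInter,
        and_assoc]
    rw [he]
    refine isClosed_Icc.inter (isClosed_iInter fun c => isClosed_iInter fun _ =>
      isClosed_iInter fun S => isClosed_iInter fun _ => ?_)
    exact isClosed_le continuous_const (hcont S)
  have hcomp : IsCompact (admissible ε m n) :=
    isCompact_Icc.of_isClosed_subset hclosed (fun f hf => ⟨hf.1, hf.2.1⟩)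
  obtain ⟨f, hf⟩ := hcomp.exists_isLeast h
  refine ⟨f, hf, ?_⟩
  refine IsLeast.csInf_eq ⟨⟨f, hf.1, rfl⟩, ?_⟩
  rintro _ ⟨g, hg, rfl⟩
  exact EReal.coe_le_coe_iff.2 (hf.2 hg)

end SparseHash

/-! Lower bound: take for S a subcube of dimension m + 2. If some row of A vanishes on the free
coordinates and meets a one in b, nothing in S survives, so S is shattered with probability at most
(1 - (1-f)^(m+2)/2)^m. This is at most 1/e < 1/2 once m(1-f)^(m+2) ≥ 2, which holds for all f ≤ log
m/(κm) and m large.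

Upper bounds: use the second moment method. The probability that x and y both survive depends only
on their Hamming distance w and decreases in w. Down-compressions never decrease the second moment,
so S may be replaced by a lower set of subsets of the coordinates (`exists_isLowerSet_pairSum_le`).
With a cutoff d, `collision_le` bounds 2^m times the conditional survival probability
((1+(1-2f)^w)/2)^m by three regimes: very close pairs cost q^w with q = exp(-2fm/5), other pairs
within d cost exp(-3m/5), and farther pairs are nearly independent. It remains to bound the average
number B of neighbours within distance d, and to choose f and d so that n q, B exp(-3m/5) and m
exp(-2fd) all tend to 0 (`eventually_mem_admissible`).

For m ~ αn, the size of a Hamming ball of radius proportional to n suffices as B. For m ~ αn^β the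
lower set is essential: its members have at most m + 2 elements, and one of the two differences of a
close pair has size at most d/2. Only that half is chosen among n points, which is where the factor
1/2 in the constant comes from. -/

namespace SparseHash

/-! ### Product structure of the law of (A, b) -/

/-- The mass that the law of a row of `A` gives to `r`. -/
noncomputable def rowWeight {n : ℕ} (f : ℝ) (r : Fin n → ZMod 2) : ℝ :=
  ∏ j, if r j = 1 then f else 1 - f

theorem rowWeight_nonneg {n : ℕ} {f : ℝ} (h0 : 0 ≤ f) (h1 : f ≤ 1) (r : Fin n → ZMod 2) :
    0 ≤ rowWeight f r :=
  Finset.prod_nonneg fun j _ => by split_ifs <;> linarith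

theorem weight_eq_prod {m n : ℕ} (f : ℝ) (A : Matrix (Fin m) (Fin n) (ZMod 2))
    (b : Fin m → ZMod 2) : weight f A b = ∏ i, rowWeight f (A i) * (1 / 2) := by
  simp [weight, rowWeight, Finset.prod_mul_distrib]

theorem weight_nonneg {m n : ℕ} {f : ℝ} (h0 : 0 ≤ f) (h1 : f ≤ 1)
    (A : Matrix (Fin m) (Fin n) (ZMod 2)) (b : Fin m → ZMod 2) : 0 ≤ weight f A b := by
  rw [weight_eq_prod]
  exact Finset.prod_nonneg fun i _ => mul_nonneg (rowWeight_nonneg h0 h1 _) (by norm_num)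

theorem sum_prod_rows {m n : ℕ} (G : (Fin n → ZMod 2) → ZMod 2 → ℝ) :
    ∑ A : Matrix (Fin m) (Fin n) (ZMod 2), ∑ b : Fin m → ZMod 2, ∏ i, G (A i) (b i)
      = (∑ r, ∑ c, G r c) ^ m := by
  have h1 : ∀ A : Matrix (Fin m) (Fin n) (ZMod 2),
      ∑ b : Fin m → ZMod 2, ∏ i, G (A i) (b i) = ∏ i, ∑ c, G (A i) c := fun A =>
    (Fintype.prod_sum fun i c => G (A i) c).symm
  simp_rw [h1]
  have h2 := Fintype.prod_sum fun (_ : Fin m) (r : Fin n → ZMod 2) => ∑ c, G r c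
  rw [Finset.prod_const, Finset.card_univ, Fintype.card_fin] at h2
  exact h2.symm

/-- An event that constrains the rows of `(A, b)` separately has a product probability. -/
theorem prob_forall_rows {m n : ℕ} (f : ℝ) (P : (Fin n → ZMod 2) → ZMod 2 → Prop)
    [∀ r c, Decidable (P r c)] :
    prob (m := m) f (fun A b => ∀ i, P (A i) (b i))
      = (∑ r, ∑ c, if P r c then rowWeight f r * (1 / 2) else 0) ^ m := by
  rw [← sum_prod_rows]
  unfold prob
  refine Finset.sum_congr rfl fun A _ => Finset.sum_congr rfl fun b _ => ?_
  rw [weight_eq_prod]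
  split_ifs with h
  · exact Finset.prod_congr rfl fun i _ => by rw [if_pos (h i)]
  · push Not at h
    obtain ⟨i, hi⟩ := h
    exact (Finset.prod_eq_zero (Finset.mem_univ i) (by rw [if_neg hi])).symm

theorem prob_mono {m n : ℕ} {f : ℝ} (h0 : 0 ≤ f) (h1 : f ≤ 1)
    {E F : Matrix (Fin m) (Fin n) (ZMod 2) → (Fin m → ZMod 2) → Prop}
    (h : ∀ A b, E A b → F A b) : prob f E ≤ prob f F := by
  unfold prob
  refine Finset.sum_le_sum fun A _ => Finset.sum_le_sum fun b _ => ?_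
  have := weight_nonneg h0 h1 A b
  split_ifs with h2 h3 h3
  · exact le_rfl
  · exact absurd (h A b h2) h3
  · exact this
  · exact le_rfl

theorem sum_rowWeight {n : ℕ} (f : ℝ) : ∑ r : Fin n → ZMod 2, rowWeight f r = 1 := by
  unfold rowWeight
  rw [← Fintype.prod_sum (fun (_ : Fin n) (a : ZMod 2) => if a = 1 then f else 1 - f)]
  apply Finset.prod_eq_one
  intro j _
  rw [show (Finset.univ : Finset (ZMod 2)) = {0, 1} from rfl]
  simp

/-! ### Characters and the probability that two points survive -/

/-- The nontrivial real character of `ZMod 2`. -/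
noncomputable def signChar (a : ZMod 2) : ℝ := if a = 0 then 1 else -1

theorem signChar_add (a b : ZMod 2) : signChar (a + b) = signChar a * signChar b := by
  have h : ∀ a b : ZMod 2, a + b = 0 ↔ (a = 0 ↔ b = 0) := by decide
  by_cases ha : a = 0 <;> by_cases hb : b = 0 <;> simp [signChar, h, ha, hb]

theorem signChar_sum {ι : Type*} (s : Finset ι) (g : ι → ZMod 2) :
    signChar (∑ i ∈ s, g i) = ∏ i ∈ s, signChar (g i) := by
  classical
  induction s using Finset.induction with
  | empty => simp [signChar]
  | insert a s ha ih => rw [Finset.sum_insert ha, Finset.prod_insert ha, signChar_add, ih]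

theorem indicator_eq_signChar (a : ZMod 2) :
    (if a = 0 then (1 : ℝ) else 0) = (1 + signChar a) / 2 := by
  unfold signChar
  split_ifs <;> norm_num

/-- The expectation factors over coordinates: each j in the support of z contributes (1 - f) - f,
every other one contributes 1. -/
theorem sum_rowWeight_mul_signChar {n : ℕ} (f : ℝ) (z : Fin n → ZMod 2) :
    ∑ r : Fin n → ZMod 2, rowWeight f r * signChar (∑ j, r j * z j)
      = (1 - 2 * f) ^ hammingNorm z := by
  have h1 : ∀ r : Fin n → ZMod 2, rowWeight f r * signChar (∑ j, r j * z j)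
      = ∏ j, (if r j = 1 then f else 1 - f) * signChar (r j * z j) := fun r => by
    rw [signChar_sum, rowWeight, Finset.prod_mul_distrib]
  simp_rw [h1]
  rw [← Fintype.prod_sum
    (fun (j : Fin n) (a : ZMod 2) => (if a = 1 then f else 1 - f) * signChar (a * z j))]
  have h2 : ∀ j : Fin n, ∑ a : ZMod 2, (if a = 1 then f else 1 - f) * signChar (a * z j)
      = if z j ≠ 0 then 1 - 2 * f else 1 := fun j => by
    rw [show (Finset.univ : Finset (ZMod 2)) = {0, 1} from rfl]
    by_cases hz : z j = 0
    · simp [hz, signChar]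
    · simp [hz, signChar]
      ring
  simp_rw [h2]
  rw [Finset.prod_ite]
  simp [hammingNorm]

theorem sum_rowWeight_dotProduct_eq_zero {n : ℕ} (f : ℝ) (z : Fin n → ZMod 2) :
    ∑ r : Fin n → ZMod 2, (if ∑ j, r j * z j = 0 then rowWeight f r else 0)
      = (1 + (1 - 2 * f) ^ hammingNorm z) / 2 := by
  have h1 : ∀ r : Fin n → ZMod 2, (if ∑ j, r j * z j = 0 then rowWeight f r else 0)
      = (rowWeight f r + rowWeight f r * signChar (∑ j, r j * z j)) / 2 := fun r => by
    have := indicator_eq_signChar (∑ j, r j * z j)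
    rw [← mul_boole, this]
    ring
  simp_rw [h1]
  rw [← Finset.sum_div, Finset.sum_add_distrib, sum_rowWeight, sum_rowWeight_mul_signChar]

theorem hash_eq_zero_iff {m n : ℕ} (A : Matrix (Fin m) (Fin n) (ZMod 2)) (b : Fin m → ZMod 2)
    (x : Fin n → ZMod 2) : hash A b x = 0 ↔ ∀ i, b i = ∑ j, A i j * x j := by
  rw [funext_iff]
  refine forall_congr' fun i => ?_
  simp only [hash, Pi.add_apply, Matrix.mulVec, dotProduct, Pi.zero_apply]
  rw [add_eq_zero_iff_eq_neg, ZMod.neg_eq_self_mod_two, eq_comm]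

/-- In each row, b i must equal the common value of the two inner products: a factor 1/2 for b i,
times the probability that the row is orthogonal to the difference of the points. -/
theorem prob_hash_pair {m n : ℕ} (f : ℝ) (x y : Fin n → ZMod 2) :
    prob (m := m) f (fun A b => hash A b x = 0 ∧ hash A b y = 0)
      = ((1 + (1 - 2 * f) ^ hammingDist x y) / 4) ^ m := by
  have h1 : prob (m := m) f (fun A b => hash A b x = 0 ∧ hash A b y = 0)
      = prob (m := m) f (fun A b => ∀ i, b i = ∑ j, A i j * x j ∧ b i = ∑ j, A i j * y j) := by
    simp only [hash_eq_zero_iff, forall_and]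
  rw [h1, prob_forall_rows f (fun r c => c = ∑ j, r j * x j ∧ c = ∑ j, r j * y j)]
  congr 1
  have h2 : ∀ r : Fin n → ZMod 2,
      ∑ c, (if c = ∑ j, r j * x j ∧ c = ∑ j, r j * y j then rowWeight f r * (1 / 2) else 0)
        = (if ∑ j, r j * (-x + y) j = 0 then rowWeight f r else 0) * (1 / 2) := fun r => by
    have h3 : ∑ j, r j * (-x + y) j = 0 ↔ ∑ j, r j * x j = ∑ j, r j * y j := by
      simp only [Pi.add_apply, Pi.neg_apply, mul_add, mul_neg, Finset.sum_add_distrib,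
        Finset.sum_neg_distrib, neg_add_eq_zero]
    simp only [h3, ite_and]
    rw [Finset.sum_ite_eq' Finset.univ]
    simp [ite_mul]
  simp_rw [h2]
  rw [← Finset.sum_mul, sum_rowWeight_dotProduct_eq_zero, hammingDist_eq_hammingNorm]
  ring

theorem prob_hash {m n : ℕ} (f : ℝ) (x : Fin n → ZMod 2) :
    prob (m := m) f (fun A b => hash A b x = 0) = (1 / 2) ^ m := by
  have := prob_hash_pair (m := m) f x x
  simp only [and_self, hammingDist_self, pow_zero] at this
  rw [this]
  norm_num

/-! ### First and second moments of the number of survivors -/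

theorem sum_matrix_sum_comm {m n : ℕ} {ι : Type*} (S : Finset ι)
    (F : Matrix (Fin m) (Fin n) (ZMod 2) → (Fin m → ZMod 2) → ι → ℝ) :
    ∑ A, ∑ b, ∑ x ∈ S, F A b x = ∑ x ∈ S, ∑ A, ∑ b, F A b x := by
  calc ∑ A, ∑ b, ∑ x ∈ S, F A b x = ∑ A, ∑ x ∈ S, ∑ b, F A b x :=
        Finset.sum_congr rfl fun A _ => Finset.sum_comm
    _ = ∑ x ∈ S, ∑ A, ∑ b, F A b x := Finset.sum_comm

theorem sum_weight_mul_survivors {m n : ℕ} (f : ℝ) (S : Finset (Fin n → ZMod 2)) :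
    ∑ A : Matrix (Fin m) (Fin n) (ZMod 2), ∑ b : Fin m → ZMod 2,
      weight f A b * (survivors S A b : ℝ) = S.card * (1 / 2) ^ m := by
  have h1 : ∀ (A : Matrix (Fin m) (Fin n) (ZMod 2)) (b : Fin m → ZMod 2),
      weight f A b * (survivors S A b : ℝ)
        = ∑ x ∈ S, if hash A b x = 0 then weight f A b else 0 := fun A b => by
    rw [survivors, ← Finset.sum_filter, Finset.sum_const, nsmul_eq_mul, mul_comm]
  simp_rw [h1]
  rw [sum_matrix_sum_comm]
  have h2 : ∀ x ∈ S, ∑ A : Matrix (Fin m) (Fin n) (ZMod 2), ∑ b : Fin m → ZMod 2,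
      (if hash A b x = 0 then weight f A b else 0) = (1 / 2) ^ m := fun x _ => by
    rw [← prob_hash f x]
    unfold prob
    refine Finset.sum_congr rfl fun A _ => Finset.sum_congr rfl fun b _ => ?_
    congr
  rw [Finset.sum_congr rfl h2, Finset.sum_const, nsmul_eq_mul]

theorem sum_weight_mul_survivors_sq {m n : ℕ} (f : ℝ) (S : Finset (Fin n → ZMod 2)) :
    ∑ A : Matrix (Fin m) (Fin n) (ZMod 2), ∑ b : Fin m → ZMod 2,
      weight f A b * (survivors S A b : ℝ) ^ 2
        = ∑ x ∈ S, ∑ y ∈ S, ((1 + (1 - 2 * f) ^ hammingDist x y) / 4) ^ m := by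
  have h1 : ∀ (A : Matrix (Fin m) (Fin n) (ZMod 2)) (b : Fin m → ZMod 2),
      weight f A b * (survivors S A b : ℝ) ^ 2
        = ∑ x ∈ S, ∑ y ∈ S, if hash A b x = 0 ∧ hash A b y = 0 then weight f A b else 0 :=
    fun A b => by
      have h2 : (survivors S A b : ℝ) = ∑ x ∈ S, if hash A b x = 0 then (1 : ℝ) else 0 := by
        rw [survivors, ← Finset.sum_filter, Finset.sum_const, nsmul_eq_mul, mul_one]
      rw [h2, sq, Finset.sum_mul_sum, Finset.mul_sum]
      refine Finset.sum_congr rfl fun x _ => ?_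
      rw [Finset.mul_sum]
      refine Finset.sum_congr rfl fun y _ => ?_
      by_cases hx : hash A b x = 0 <;> by_cases hy : hash A b y = 0 <;> simp [hx, hy]
  simp_rw [h1]
  rw [sum_matrix_sum_comm]
  refine Finset.sum_congr rfl fun x _ => ?_
  rw [sum_matrix_sum_comm]
  refine Finset.sum_congr rfl fun y _ => ?_
  rw [← prob_hash_pair]
  unfold prob
  refine Finset.sum_congr rfl fun A _ => Finset.sum_congr rfl fun b _ => ?_
  congr

/-- The second moment method for the number of survivors. -/
theorem sq_card_le_prob_mul {m n : ℕ} {f : ℝ} (h0 : 0 ≤ f) (h1 : f ≤ 1)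
    (S : Finset (Fin n → ZMod 2)) :
    (S.card * (1 / 2 : ℝ) ^ m) ^ 2 ≤ prob (m := m) f (fun A b => 1 ≤ survivors S A b) *
      ∑ x ∈ S, ∑ y ∈ S, ((1 + (1 - 2 * f) ^ hammingDist x y) / 4) ^ m := by
  classical
  rw [← sum_weight_mul_survivors f S, ← sum_weight_mul_survivors_sq f S]
  unfold prob
  rw [← Fintype.sum_prod_type', ← Fintype.sum_prod_type', ← Fintype.sum_prod_type']
  -- Cauchy–Schwarz for the product of the indicator of X ≥ 1 with X, which is X itself since X is a
  -- natural number.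
  refine Finset.sum_sq_le_sum_mul_sum_of_sq_le_mul _ (fun p _ => ?_) (fun p _ => ?_)
    (fun p _ => ?_)
  · have := weight_nonneg h0 h1 p.1 p.2
    split_ifs
    exacts [this, le_rfl]
  · exact mul_nonneg (weight_nonneg h0 h1 p.1 p.2) (sq_nonneg _)
  · by_cases hs : 1 ≤ survivors S p.1 p.2
    · rw [if_pos hs]
      exact le_of_eq (by ring)
    · have : survivors S p.1 p.2 = 0 := by omega
      simp [this]

/-! ### Subcubes, the obstruction behind the lower bound -/

/-- The vectors that vanish outside the first `k` coordinates. -/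
def subcube (n k : ℕ) : Finset (Fin n → ZMod 2) :=
  Fintype.piFinset fun j => if (j : ℕ) < k then Finset.univ else {0}

theorem prod_ite_val_lt {n k : ℕ} (h : k ≤ n) {M : Type*} [CommMonoid M] (c : M) :
    ∏ j : Fin n, (if (j : ℕ) < k then c else 1) = c ^ k := by
  rw [Finset.prod_ite, Finset.prod_const, Finset.prod_const_one, mul_one]
  congr 1
  rw [Fin.card_filter_val_lt, min_eq_right h]

theorem card_subcube {n k : ℕ} (h : k ≤ n) : (subcube n k).card = 2 ^ k := by
  rw [subcube, Fintype.card_piFinset, ← prod_ite_val_lt h]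
  refine Finset.prod_congr rfl fun j _ => ?_
  split_ifs
  · rfl
  · rfl

theorem sum_rowWeight_eq_zero_of_lt {n k : ℕ} (h : k ≤ n) (f : ℝ) :
    ∑ r : Fin n → ZMod 2, (if ∀ j : Fin n, (j : ℕ) < k → r j = 0 then rowWeight f r else 0)
      = (1 - f) ^ k := by
  have h1 : ∀ r : Fin n → ZMod 2,
      (if ∀ j : Fin n, (j : ℕ) < k → r j = 0 then rowWeight f r else 0)
        = ∏ j : Fin n, if (j : ℕ) < k → r j = 0 then (if r j = 1 then f else 1 - f) else 0 := fun r => by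
    split_ifs with hr
    · exact Finset.prod_congr rfl fun j _ => by rw [if_pos (hr j)]
    · push Not at hr
      obtain ⟨j, hj⟩ := hr
      refine (Finset.prod_eq_zero (Finset.mem_univ j) (if_neg ?_)).symm
      exact fun h => hj.2 (h hj.1)
  simp_rw [h1]
  rw [← Fintype.prod_sum (fun (j : Fin n) (a : ZMod 2) =>
    if (j : ℕ) < k → a = 0 then (if a = 1 then f else 1 - f) else 0), ← prod_ite_val_lt h]
  refine Finset.prod_congr rfl fun j _ => ?_
  rw [show (Finset.univ : Finset (ZMod 2)) = {0, 1} from rfl]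
  by_cases hj : (j : ℕ) < k <;> simp [hj]

/-- A hash function has a zero on a subcube only if no row of `A` that vanishes on its coordinates
meets a one in `b`. -/
theorem prob_survivors_subcube_le {m n k : ℕ} (h : k ≤ n) {f : ℝ} (h0 : 0 ≤ f) (h1 : f ≤ 1) :
    prob (m := m) f (fun A b => 1 ≤ survivors (subcube n k) A b)
      ≤ (1 - (1 - f) ^ k / 2) ^ m := by
  calc prob (m := m) f (fun A b => 1 ≤ survivors (subcube n k) A b)
      ≤ prob (m := m) f
          (fun A b => ∀ i, ¬ ((∀ j : Fin n, (j : ℕ) < k → A i j = 0) ∧ b i = 1)) := by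
        refine prob_mono h0 h1 fun A b hs i hi => ?_
        obtain ⟨x, hx⟩ := Finset.card_pos.1 hs
        rw [Finset.mem_filter, subcube, Fintype.mem_piFinset, hash_eq_zero_iff] at hx
        have h2 : ∑ j, A i j * x j = 0 := Finset.sum_eq_zero fun j _ => by
          by_cases hj : (j : ℕ) < k
          · rw [hi.1 j hj, zero_mul]
          · have := hx.1 j
            rw [if_neg hj, Finset.mem_singleton] at this
            rw [this, mul_zero]
        have h3 := hx.2 i
        rw [h2, hi.2] at h3
        exact one_ne_zero h3
    _ = (1 - (1 - f) ^ k / 2) ^ m := by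
        rw [prob_forall_rows f
          (fun r c => ¬ ((∀ j : Fin n, (j : ℕ) < k → r j = 0) ∧ c = 1))]
        congr 1
        have h2 : ∀ r : Fin n → ZMod 2,
            ∑ c : ZMod 2, (if ¬ ((∀ j : Fin n, (j : ℕ) < k → r j = 0) ∧ c = 1)
              then rowWeight f r * (1 / 2) else 0) = rowWeight f r
              - (if ∀ j : Fin n, (j : ℕ) < k → r j = 0 then rowWeight f r else 0) / 2 :=
          fun r => by
            rw [show (Finset.univ : Finset (ZMod 2)) = {0, 1} from rfl]
            rw [Finset.sum_pair (by decide)]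
            rw [if_pos fun h => absurd h.2 (by decide)]
            by_cases hr : ∀ j : Fin n, (j : ℕ) < k → r j = 0
            · rw [if_neg fun h => h ⟨hr, rfl⟩, if_pos hr]
              ring
            · rw [if_pos fun h => hr h.1, if_neg hr]
              ring
        simp_rw [h2]
        rw [Finset.sum_sub_distrib, sum_rowWeight, ← Finset.sum_div,
          sum_rowWeight_eq_zero_of_lt h]

/-- All subsets of `s` belong to the family. Hence a lower set with 2^(m+2) members has no member
with more than m + 2 elements. -/
theorem two_pow_card_le_card {α : Type*} {𝒜 : Finset (Finset α)}
    (h : IsLowerSet (𝒜 : Set (Finset α))) {s : Finset α} (hs : s ∈ 𝒜) :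
    2 ^ s.card ≤ 𝒜.card := by
  rw [← Finset.card_powerset]
  exact Finset.card_le_card fun t ht => h (Finset.mem_powerset.1 ht) hs

/-! ### Down-compression and pair sums -/

section Compression

open Finset
open scoped FinsetFamily symmDiff

variable {α : Type*} [DecidableEq α]

/-- The sum of `g` over the distances between the members of a set family. -/
def pairSum (g : ℕ → ℝ) (𝒜 : Finset (Finset α)) : ℝ :=
  ∑ s ∈ 𝒜, ∑ t ∈ 𝒜, g (s ∆ t).card

theorem card_insert_symmDiff {a : α} {u v : Finset α} (hu : a ∉ u) (hv : a ∉ v) :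
    (insert a u ∆ v).card = (u ∆ v).card + 1 := by
  have h : insert a u ∆ v = insert a (u ∆ v) := by
    ext x
    by_cases hx : x = a
    · subst hx
      simp [mem_symmDiff, hv]
    · simp [mem_symmDiff, hx]
  rw [h, card_insert_of_notMem (by simp [mem_symmDiff, hu, hv])]

theorem insert_symmDiff_insert {a : α} {u v : Finset α} (hu : a ∉ u) (hv : a ∉ v) :
    insert a u ∆ insert a v = u ∆ v := by
  ext x
  by_cases hx : x = a
  · subst hx
    simp [mem_symmDiff, hu, hv]
  · simp [mem_symmDiff, hx]

theorem sum_eq_sum_powerset_erase [Fintype α] (a : α) (h : Finset α → ℝ) :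
    ∑ s, h s = ∑ u ∈ (univ.erase a).powerset, (h u + h (insert a u)) := by
  rw [sum_add_distrib, ← sum_powerset_insert (notMem_erase a univ), insert_erase (mem_univ a),
    powerset_univ]

/-- Pairs are grouped by their traces `u`, `v` off `a`; within a group only the distances |u ∆ v|
and |u ∆ v| + 1 occur. -/
theorem pairSum_eq [Fintype α] (g : ℕ → ℝ) (a : α) (𝒜 : Finset (Finset α)) :
    pairSum g 𝒜 = ∑ u ∈ (univ.erase a).powerset, ∑ v ∈ (univ.erase a).powerset,
      (((if u ∈ 𝒜 then if v ∈ 𝒜 then g (u ∆ v).card else 0 else 0)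
        + (if u ∈ 𝒜 then if insert a v ∈ 𝒜 then g ((u ∆ v).card + 1) else 0 else 0))
        + ((if insert a u ∈ 𝒜 then if v ∈ 𝒜 then g ((u ∆ v).card + 1) else 0 else 0)
        + (if insert a u ∈ 𝒜 then if insert a v ∈ 𝒜 then g (u ∆ v).card else 0 else 0))) := by
  have h1 : pairSum g 𝒜 = ∑ s, ∑ t, if s ∈ 𝒜 then if t ∈ 𝒜 then g (s ∆ t).card else 0 else 0 := by
    have h2 : ∀ h : Finset α → ℝ, ∑ s ∈ 𝒜, h s = ∑ s, if s ∈ 𝒜 then h s else 0 := fun h => by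
      rw [← sum_filter, filter_mem_eq_inter, univ_inter]
    rw [pairSum, h2]
    refine sum_congr rfl fun s _ => ?_
    split_ifs
    · exact h2 _
    · exact sum_const_zero.symm
  rw [h1, sum_eq_sum_powerset_erase a]
  refine sum_congr rfl fun u hu => ?_
  rw [sum_eq_sum_powerset_erase a, sum_eq_sum_powerset_erase a, ← sum_add_distrib]
  refine sum_congr rfl fun v hv => ?_
  have hau : a ∉ u := fun h => by simpa using mem_powerset.1 hu h
  have hav : a ∉ v := fun h => by simpa using mem_powerset.1 hv h
  rw [insert_symmDiff_insert hau hav, card_insert_symmDiff hau hav, symmDiff_comm u (insert a v),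
    card_insert_symmDiff hav hau, symmDiff_comm v u]

/-- The inequality holds for each pair of traces. Compression preserves the number of sets over each
trace; for instance, if only `u` and `insert a v` are present, their distance drops by one, and `g`
is antitone. -/
theorem pairSum_le_pairSum_compression [Fintype α] {g : ℕ → ℝ} (hg : Antitone g) (a : α)
    (𝒜 : Finset (Finset α)) : pairSum g 𝒜 ≤ pairSum g (𝓓 a 𝒜) := by
  rw [pairSum_eq g a, pairSum_eq g a]
  refine sum_le_sum fun u hu => sum_le_sum fun v hv => ?_
  have hau : a ∉ u := fun h => by simpa using mem_powerset.1 hu h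
  have hav : a ∉ v := fun h => by simpa using mem_powerset.1 hv h
  have h1 := hg (Nat.le_succ (u ∆ v).card)
  simp only [Nat.succ_eq_add_one] at h1
  simp only [Down.mem_compression, erase_insert hau, erase_insert hav, erase_eq_of_notMem hau,
    erase_eq_of_notMem hav, insert_idem]
  by_cases h2 : u ∈ 𝒜 <;> by_cases h3 : v ∈ 𝒜 <;> by_cases h4 : insert a u ∈ 𝒜 <;>
    by_cases h5 : insert a v ∈ 𝒜 <;> simp [h2, h3, h4, h5] <;> linarith

/-- The total size strictly drops under an effective compression, so repeated compression
terminates. -/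
theorem sum_card_compression_lt {a : α} {𝒜 : Finset (Finset α)} {s : Finset α} (hs : s ∈ 𝒜)
    (has : s.erase a ∉ 𝒜) : ∑ t ∈ 𝓓 a 𝒜, t.card < ∑ t ∈ 𝒜, t.card := by
  rw [Down.compression, sum_disjUnion, filter_image, sum_image]
  · rw [← sum_filter_add_sum_filter_not 𝒜 (fun t => t.erase a ∈ 𝒜)]
    refine Nat.add_lt_add_left (sum_lt_sum_of_nonempty ⟨s, mem_filter.2 ⟨hs, has⟩⟩ fun t ht => ?_) _
    refine card_erase_lt_of_mem ?_
    by_contra hat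
    rw [mem_filter, erase_eq_of_notMem hat] at ht
    exact ht.2 ht.1
  · refine (erase_injOn' a).mono fun t ht => ?_
    by_contra hat
    rw [mem_coe, mem_filter] at ht
    rw [erase_eq_of_notMem hat] at ht
    exact ht.2 ht.1

theorem isLowerSet_of_erase_mem {𝒜 : Finset (Finset α)}
    (h : ∀ s ∈ 𝒜, ∀ a ∈ s, s.erase a ∈ 𝒜) : IsLowerSet (𝒜 : Set (Finset α)) := by
  intro s t hts hs
  obtain ⟨k, hk⟩ : ∃ k, (s \ t).card = k := ⟨_, rfl⟩
  induction k generalizing s with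
  | zero =>
    rw [card_eq_zero, sdiff_eq_empty_iff_subset] at hk
    rwa [Subset.antisymm hts hk]
  | succ k ih =>
    obtain ⟨a, ha⟩ : (s \ t).Nonempty := card_pos.1 (by omega)
    obtain ⟨has, hat⟩ := mem_sdiff.1 ha
    refine ih (subset_erase.2 ⟨hts, hat⟩) (h s hs a has) ?_
    rw [erase_sdiff_comm, card_erase_of_mem ha, hk, Nat.add_sub_cancel]

/-- Among the set families of a given size, a lower set maximizes `pairSum`. -/
theorem exists_isLowerSet_pairSum_le [Fintype α] {g : ℕ → ℝ} (hg : Antitone g)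
    (𝒜 : Finset (Finset α)) : ∃ ℬ : Finset (Finset α),
      IsLowerSet (ℬ : Set (Finset α)) ∧ ℬ.card = 𝒜.card ∧ pairSum g 𝒜 ≤ pairSum g ℬ := by
  obtain ⟨k, hk⟩ : ∃ k, ∑ t ∈ 𝒜, t.card = k := ⟨_, rfl⟩
  induction k using Nat.strong_induction_on generalizing 𝒜 with
  | _ k ih =>
    by_cases h : ∀ s ∈ 𝒜, ∀ a ∈ s, s.erase a ∈ 𝒜
    · exact ⟨𝒜, isLowerSet_of_erase_mem h, rfl, le_rfl⟩
    · push Not at h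
      obtain ⟨s, hs, a, -, has⟩ := h
      obtain ⟨ℬ, h1, h2, h3⟩ := ih _ (hk ▸ sum_card_compression_lt hs has) (𝓓 a 𝒜) rfl
      exact ⟨ℬ, h1, h2.trans (Down.card_compression a 𝒜),
        (pairSum_le_pairSum_compression hg a 𝒜).trans h3⟩

end Compression

/-! ### Counting close pairs in a set family -/

section Counting

open Finset
open scoped symmDiff

/-- A Chernoff-type bound for the number of small subsets of a finite set. -/
theorem card_powerset_filter_card_le {α : Type*} (u : Finset α) {d : ℕ} {D x : ℝ} (hd : (d : ℝ) ≤ D)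
    (hx : 0 < x) (hx1 : x ≤ 1) :
    ((u.powerset.filter fun t => t.card ≤ d).card : ℝ)
      ≤ Real.exp (u.card * x - D * Real.log x) := by
  have h1 : ((u.powerset.filter fun t => t.card ≤ d).card : ℝ) * x ^ d ≤ (x + 1) ^ u.card := by
    rw [← Finset.sum_pow_mul_eq_add_pow, ← nsmul_eq_mul, ← sum_const]
    calc ∑ _t ∈ u.powerset.filter fun t => t.card ≤ d, x ^ d
        ≤ ∑ t ∈ u.powerset.filter fun t => t.card ≤ d, x ^ t.card * 1 ^ (u.card - t.card) := by
          refine sum_le_sum fun t ht => ?_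
          rw [one_pow, mul_one]
          exact pow_le_pow_of_le_one hx.le hx1 (mem_filter.1 ht).2
      _ ≤ ∑ t ∈ u.powerset, x ^ t.card * 1 ^ (u.card - t.card) :=
          sum_le_sum_of_subset_of_nonneg (filter_subset _ _) fun t _ _ => by positivity
  have h2 : (x + 1) ^ u.card ≤ Real.exp (u.card * x) := by
    rw [Real.exp_nat_mul]
    exact pow_le_pow_left₀ (by linarith) (Real.add_one_le_exp x) _
  have h3 : Real.exp (D * Real.log x) ≤ x ^ d := by
    rw [← Real.exp_log (pow_pos hx d), Real.log_pow]
    exact Real.exp_le_exp.2 (mul_le_mul_of_nonpos_right hd (Real.log_nonpos hx.le hx1))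
  rw [Real.exp_sub, le_div_iff₀ (Real.exp_pos _)]
  calc _ ≤ ((u.powerset.filter fun t => t.card ≤ d).card : ℝ) * x ^ d := by gcongr
    _ ≤ _ := h1.trans h2

variable {α : Type*} [DecidableEq α]

theorem card_filter_symmDiff_le [Fintype α] (ℬ : Finset (Finset α)) (s : Finset α) (d : ℕ) :
    (ℬ.filter fun t => (s ∆ t).card ≤ d).card
      ≤ ((univ : Finset α).powerset.filter fun t => t.card ≤ d).card := by
  refine card_le_card_of_injOn (fun t => s ∆ t) (fun t ht => ?_) fun t _ t' _ h => ?_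
  · simpa using (mem_filter.1 ht).2
  · exact symmDiff_right_injective s h

theorem card_filter_symmDiff_sdiff_le [Fintype α] (ℬ : Finset (Finset α)) (s : Finset α)
    (d e : ℕ) :
    (ℬ.filter fun t => (s ∆ t).card ≤ d ∧ (t \ s).card ≤ e).card
      ≤ (s.powerset.filter fun a => a.card ≤ d).card
        * ((univ : Finset α).powerset.filter fun b => b.card ≤ e).card := by
  rw [← card_product]
  refine card_le_card_of_injOn (fun t => (s \ t, t \ s)) (fun t ht => ?_) fun t _ t' _ h => ?_
  · have h := (mem_filter.1 ht).2
    have h1 : (s \ t).card ≤ (s ∆ t).card := card_le_card le_sup_left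
    simp only [coe_product, Set.mem_prod, mem_coe, mem_filter, mem_powerset]
    exact ⟨⟨sdiff_subset, h1.trans h.1⟩, subset_univ _, h.2⟩
  · refine symmDiff_right_injective s ?_
    simp only [Prod.mk.injEq] at h
    simp only [symmDiff, h.1, h.2]

/-- In a family of sets with at most `k` elements few pairs are close to each other: one of the two
differences of a close pair is at most half as large as the distance. -/
theorem sum_card_filter_symmDiff_le [Fintype α] {ℬ : Finset (Finset α)} {d e : ℕ}
    (hde : d ≤ 2 * e + 1) {U V : ℝ}
    (hU : ∀ s ∈ ℬ, ((s.powerset.filter fun a => a.card ≤ d).card : ℝ) ≤ U)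
    (hV : (((univ : Finset α).powerset.filter fun b => b.card ≤ e).card : ℝ) ≤ V) :
    ∑ s ∈ ℬ, ((ℬ.filter fun t => (s ∆ t).card ≤ d).card : ℝ) ≤ ℬ.card * (2 * (U * V)) := by
  have h1 : ∑ s ∈ ℬ, ((ℬ.filter fun t => (s ∆ t).card ≤ d ∧ (t \ s).card ≤ e).card : ℝ)
      ≤ ℬ.card * (U * V) := by
    rw [← nsmul_eq_mul]
    refine sum_le_card_nsmul _ _ _ fun s hs => ?_
    calc _ ≤ (((s.powerset.filter fun a => a.card ≤ d).card
        * ((univ : Finset α).powerset.filter fun b => b.card ≤ e).card : ℕ) : ℝ) :=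
          Nat.cast_le.2 (card_filter_symmDiff_sdiff_le ℬ s d e)
      _ ≤ U * V := by
          rw [Nat.cast_mul]
          exact mul_le_mul (hU s hs) hV (Nat.cast_nonneg _) ((Nat.cast_nonneg _).trans (hU s hs))
  -- If |t \ s| ≥ e + 1, then |s \ t| ≤ d - e - 1 ≤ e. The second kind of pair becomes the first on
  -- exchanging the names of `s` and `t`.
  have h2 : ∀ s ∈ ℬ, ((ℬ.filter fun t => (s ∆ t).card ≤ d).card : ℝ)
      ≤ (ℬ.filter fun t => (s ∆ t).card ≤ d ∧ (t \ s).card ≤ e).card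
        + (ℬ.filter fun t => (t ∆ s).card ≤ d ∧ (s \ t).card ≤ e).card := fun s _ => by
    rw [← Nat.cast_add, Nat.cast_le]
    refine le_trans (card_le_card fun t ht => ?_) (card_union_le _ _)
    rw [mem_filter] at ht
    have h3 : (s ∆ t).card = (s \ t).card + (t \ s).card :=
      card_union_of_disjoint disjoint_sdiff_sdiff
    rw [mem_union, mem_filter, mem_filter, symmDiff_comm t s]
    by_cases h4 : (t \ s).card ≤ e
    · exact Or.inl ⟨ht.1, ht.2, h4⟩
    · exact Or.inr ⟨ht.1, ht.2, by omega⟩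
  have h3 : ∑ s ∈ ℬ, ((ℬ.filter fun t => (t ∆ s).card ≤ d ∧ (s \ t).card ≤ e).card : ℝ)
      = ∑ s ∈ ℬ, ((ℬ.filter fun t => (s ∆ t).card ≤ d ∧ (t \ s).card ≤ e).card : ℝ) := by
    simp only [card_filter, Nat.cast_sum]
    exact sum_comm
  calc _ ≤ _ := sum_le_sum h2
    _ ≤ ℬ.card * (2 * (U * V)) := by
        rw [sum_add_distrib, h3]
        linarith

/-- The geometric term is summed over all t, close or not: translation by `s` turns the sum into
(1+q)^|α| ≤ exp(|α| q). The diagonal accounts for the 1 in it. -/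
theorem pairSum_le [Fintype α] {g : ℕ → ℝ} {q b c B : ℝ} {d : ℕ} (ℬ : Finset (Finset α))
    (hq : 0 ≤ q) (hb : 0 ≤ b) (hg : ∀ w, g w ≤ q ^ w + (if w ≤ d then b else 0) + c)
    (hB : ∑ s ∈ ℬ, ((ℬ.filter fun t => (s ∆ t).card ≤ d).card : ℝ) ≤ ℬ.card * B) :
    pairSum g ℬ ≤ ℬ.card * (Real.exp (Fintype.card α * q) + B * b) + ℬ.card ^ 2 * c := by
  have h1 : ∀ s : Finset α, ∑ t ∈ ℬ, q ^ (s ∆ t).card ≤ Real.exp (Fintype.card α * q) :=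
    fun s => by
      calc ∑ t ∈ ℬ, q ^ (s ∆ t).card ≤ ∑ t, q ^ (s ∆ t).card :=
            sum_le_sum_of_subset_of_nonneg (subset_univ _) fun t _ _ => by positivity
        _ = ∑ t : Finset α, q ^ t.card :=
            (symmDiff_right_involutive s).bijective.sum_comp fun t => q ^ t.card
        _ = (q + 1) ^ Fintype.card α := by
            rw [← Fintype.sum_pow_mul_eq_add_pow]
            simp
        _ ≤ Real.exp (Fintype.card α * q) := by
            rw [Real.exp_nat_mul]
            exact pow_le_pow_left₀ (by linarith) (Real.add_one_le_exp q) _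
  calc pairSum g ℬ
      ≤ ∑ s ∈ ℬ, ∑ t ∈ ℬ, (q ^ (s ∆ t).card + (if (s ∆ t).card ≤ d then b else 0) + c) :=
        sum_le_sum fun s _ => sum_le_sum fun t _ => hg _
    _ = ∑ s ∈ ℬ, (∑ t ∈ ℬ, q ^ (s ∆ t).card) + (∑ s ∈ ℬ,
          ((ℬ.filter fun t => (s ∆ t).card ≤ d).card : ℝ)) * b + ℬ.card ^ 2 * c := by
        simp only [sum_add_distrib, ← sum_filter, sum_const, nsmul_eq_mul, sum_mul]
        ring
    _ ≤ ℬ.card * Real.exp (Fintype.card α * q) + ℬ.card * B * b + ℬ.card ^ 2 * c := by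
        gcongr
        rw [← nsmul_eq_mul]
        exact sum_le_card_nsmul _ _ _ fun s _ => h1 s
    _ = _ := by ring

end Counting

/-! ### The second moment bound for arbitrary sets of vectors -/

/-- The set of coordinates at which a vector is one. -/
def ones {n : ℕ} (x : Fin n → ZMod 2) : Finset (Fin n) := Finset.univ.filter fun j => x j = 1

theorem ones_injective {n : ℕ} : Function.Injective (ones (n := n)) := fun x y h => by
  have h0 : ∀ a b : ZMod 2, (a = 1 ↔ b = 1) → a = b := by decide
  funext j
  refine h0 _ _ ?_
  have := Finset.ext_iff.1 h j
  simpa [ones] using this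

open scoped symmDiff in
theorem card_ones_symmDiff {n : ℕ} (x y : Fin n → ZMod 2) :
    (ones x ∆ ones y).card = hammingDist x y := by
  have h0 : ∀ a b : ZMod 2, (a = 1 ∧ b ≠ 1 ∨ b = 1 ∧ a ≠ 1) ↔ a ≠ b := by decide
  unfold hammingDist
  congr 1
  ext j
  simp only [Finset.mem_symmDiff, ones, Finset.mem_filter, Finset.mem_univ, true_and]
  exact h0 _ _

theorem sum_hammingDist_eq_pairSum {n : ℕ} (g : ℕ → ℝ) (S : Finset (Fin n → ZMod 2)) :
    ∑ x ∈ S, ∑ y ∈ S, g (hammingDist x y) = pairSum g (S.map ⟨ones, ones_injective⟩) := by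
  simp [pairSum, Finset.sum_map, card_ones_symmDiff]

theorem exp_three_fifths_le : Real.exp (3 / 5) ≤ 1.83 := by
  refine le_of_pow_le_pow_left₀ (n := 5) (by norm_num) (by norm_num) ?_
  have : Real.exp (3 / 5) ^ 5 = Real.exp 1 ^ 3 := by
    rw [← Real.exp_nat_mul, ← Real.exp_nat_mul]
    norm_num
  rw [this]
  calc Real.exp 1 ^ 3 ≤ 2.7183 ^ 3 := by gcongr; linarith [Real.exp_one_lt_d9]
    _ ≤ 1.83 ^ 5 := by norm_num

/-- Equivalently e^(t/5) + e^(-4t/5) ≤ 2. The left side is convex in t, equals 2 at t = 0, and is at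
most 1.83 + 1/6 < 2 at t = 3, so its chord on [0, 3] stays below 2. -/
theorem half_one_add_exp_neg_le {t : ℝ} (h0 : 0 ≤ t) (h3 : t ≤ 3) :
    (1 + Real.exp (-t)) / 2 ≤ Real.exp (-(t / 5)) := by
  have hconv : ∀ a : ℝ, Real.exp (t / 3 * a) ≤ 1 - t / 3 + t / 3 * Real.exp a := fun a => by
    have := convexOn_exp.2 (Set.mem_univ 0) (Set.mem_univ a)
      (show (0 : ℝ) ≤ 1 - t / 3 by linarith) (show 0 ≤ t / 3 by linarith) (by ring)
    simpa using this
  have h1 := hconv (3 / 5)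
  have h2 := hconv (-(12 / 5))
  have h4 : Real.exp (-(12 / 5)) ≤ 1 / 6 := by
    rw [Real.exp_neg, one_div]
    refine inv_anti₀ (by norm_num) ?_
    linarith [Real.quadratic_le_exp_of_nonneg (x := 12 / 5) (by norm_num)]
  have h5 : Real.exp (t / 3 * (3 / 5)) + Real.exp (t / 3 * -(12 / 5)) ≤ 2 := by
    have := exp_three_fifths_le
    nlinarith
  have h6 : 1 + Real.exp (-t) = Real.exp (-(t / 5)) *
      (Real.exp (t / 3 * (3 / 5)) + Real.exp (t / 3 * -(12 / 5))) := by
    rw [mul_add, ← Real.exp_add, ← Real.exp_add, ← Real.exp_zero]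
    congr 2 <;> ring
  rw [h6]
  nlinarith [Real.exp_pos (-(t / 5))]

/-- The three terms serve 2fw ≤ 3, then 2fw > 3 with w ≤ d, then w > d. In the second regime the
base is at most (1 + 1/20)/2 < 1/1.83 ≤ e^(-3/5). -/
theorem collision_le {m d : ℕ} {f : ℝ} (h0 : 0 ≤ f) (h1 : f ≤ 1 / 2) (w : ℕ) :
    ((1 + (1 - 2 * f) ^ w) / 2) ^ m
      ≤ Real.exp (-(2 / 5 * f * m)) ^ w + (if w ≤ d then Real.exp (-(3 / 5 * m)) else 0)
        + Real.exp (m * Real.exp (-(2 * f * d))) * (1 / 2) ^ m := by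
  have hr : ∀ k : ℕ, (1 - 2 * f) ^ k ≤ Real.exp (-(2 * f * k)) := fun k => by
    rw [show -(2 * f * k) = k * (-(2 * f)) by ring, Real.exp_nat_mul]
    exact pow_le_pow_left₀ (by linarith) (by linarith [Real.add_one_le_exp (-(2 * f))]) _
  have hr0 : 0 ≤ (1 - 2 * f) ^ w := pow_nonneg (by linarith) _
  have hpos : 0 ≤ Real.exp (m * Real.exp (-(2 * f * d))) * (1 / 2) ^ m := by positivity
  rcases le_or_gt (2 * f * w) 3 with ht | ht
  · have h2 : (1 + (1 - 2 * f) ^ w) / 2 ≤ Real.exp (-(2 * f * w / 5)) := by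
      linarith [hr w, half_one_add_exp_neg_le (by positivity) ht]
    have h3 : ((1 + (1 - 2 * f) ^ w) / 2) ^ m ≤ Real.exp (-(2 / 5 * f * m)) ^ w := by
      calc _ ≤ Real.exp (-(2 * f * w / 5)) ^ m := pow_le_pow_left₀ (by linarith) h2 _
        _ = _ := by
          rw [← Real.exp_nat_mul, ← Real.exp_nat_mul]
          congr 1
          ring
    have h4 : 0 ≤ (if w ≤ d then Real.exp (-(3 / 5 * m)) else 0) := by split_ifs <;> positivity
    linarith
  have hpos2 : 0 ≤ Real.exp (-(2 / 5 * f * m)) ^ w := by positivity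
  rcases le_or_gt w d with hw | hw
  · rw [if_pos hw]
    have h2 : (1 + (1 - 2 * f) ^ w) / 2 ≤ Real.exp (-(3 / 5)) := by
      have h3 : Real.exp (-(2 * f * w)) ≤ Real.exp (-3) := Real.exp_le_exp.2 (by linarith)
      have h4 : Real.exp (-3) ≤ 1 / 20 := by
        have : Real.exp 3 = Real.exp 1 ^ 3 := by rw [← Real.exp_nat_mul]; norm_num
        rw [Real.exp_neg, this, one_div]
        refine inv_anti₀ (by norm_num) ?_
        calc (20 : ℝ) ≤ 2.718 ^ 3 := by norm_num
          _ ≤ Real.exp 1 ^ 3 := by gcongr; linarith [Real.exp_one_gt_d9]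
      have h5 : (1.83 : ℝ)⁻¹ ≤ Real.exp (-(3 / 5)) := by
        rw [Real.exp_neg]
        exact inv_anti₀ (Real.exp_pos _) exp_three_fifths_le
      norm_num at h5
      linarith [hr w]
    have h3 : ((1 + (1 - 2 * f) ^ w) / 2) ^ m ≤ Real.exp (-(3 / 5 * m)) := by
      calc _ ≤ Real.exp (-(3 / 5)) ^ m := pow_le_pow_left₀ (by linarith) h2 _
        _ = _ := by
          rw [← Real.exp_nat_mul]
          congr 1
          ring
    linarith
  · rw [if_neg hw.not_ge, add_zero]
    have h2 : (1 - 2 * f) ^ w ≤ Real.exp (-(2 * f * d)) := (hr w).trans <| Real.exp_le_exp.2 <| by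
      have : (d : ℝ) ≤ w := by exact_mod_cast hw.le
      nlinarith
    have h3 : ((1 + (1 - 2 * f) ^ w) / 2) ^ m
        ≤ Real.exp (m * Real.exp (-(2 * f * d))) * (1 / 2) ^ m := by
      rw [div_eq_mul_one_div, mul_pow, Real.exp_nat_mul]
      refine mul_le_mul_of_nonneg_right (pow_le_pow_left₀ (by linarith) ?_ _) (by positivity)
      linarith [Real.add_one_le_exp (Real.exp (-(2 * f * d)))]
    linarith

open scoped symmDiff in
-- The mean number of survivors is 4. After division by its square 16, the near pairs carry the
-- factor 1/4 and the far pairs the factor 1.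
theorem one_le_prob_mul {m n : ℕ} {f : ℝ} (h0 : 0 ≤ f) (h1 : f ≤ 1 / 2) (d : ℕ) {B : ℝ}
    (hB : ∀ ℬ : Finset (Finset (Fin n)), IsLowerSet (ℬ : Set (Finset (Fin n))) →
      ℬ.card = 2 ^ (m + 2) →
      ∑ s ∈ ℬ, ((ℬ.filter fun t => (s ∆ t).card ≤ d).card : ℝ) ≤ ℬ.card * B)
    {S : Finset (Fin n → ZMod 2)} (hS : S.card = 2 ^ (m + 2)) :
    1 ≤ prob (m := m) f (fun A b => 1 ≤ survivors S A b) *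
      ((Real.exp (n * Real.exp (-(2 / 5 * f * m))) + B * Real.exp (-(3 / 5 * m))) / 4
        + Real.exp (m * Real.exp (-(2 * f * d)))) := by
  set g : ℕ → ℝ := fun w => ((1 + (1 - 2 * f) ^ w) / 2) ^ m with hg
  have hanti : Antitone g := fun v w hvw => by
    have h2 : (1 - 2 * f) ^ w ≤ (1 - 2 * f) ^ v :=
      pow_le_pow_of_le_one (by linarith) (by linarith) hvw
    have h3 : 0 ≤ (1 - 2 * f) ^ w := pow_nonneg (by linarith) _
    exact pow_le_pow_left₀ (by linarith) (by linarith) _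
  obtain ⟨ℬ, hlow, hcard, hle⟩ :=
    exists_isLowerSet_pairSum_le hanti (S.map ⟨ones, ones_injective⟩)
  rw [Finset.card_map, hS] at hcard
  rw [← sum_hammingDist_eq_pairSum] at hle
  have h2 := pairSum_le ℬ (Real.exp_pos _).le (Real.exp_pos _).le
    (collision_le (m := m) (d := d) h0 h1) (hB ℬ hlow hcard)
  have h3 := sq_card_le_prob_mul (m := m) h0 (by linarith) S
  have h4 : ∑ x ∈ S, ∑ y ∈ S, ((1 + (1 - 2 * f) ^ hammingDist x y) / 4) ^ m
      = (∑ x ∈ S, ∑ y ∈ S, g (hammingDist x y)) * (1 / 2) ^ m := by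
    simp only [Finset.sum_mul, hg, ← mul_pow]
    refine Finset.sum_congr rfl fun x _ => Finset.sum_congr rfl fun y _ => ?_
    congr 1
    ring
  have hp : 0 ≤ prob (m := m) f (fun A b => 1 ≤ survivors S A b) := by
    unfold prob
    refine Finset.sum_nonneg fun A _ => Finset.sum_nonneg fun b _ => ?_
    split_ifs
    exacts [weight_nonneg h0 (by linarith) A b, le_rfl]
  have h5 : (2 : ℝ) ^ m * (1 / 2) ^ m = 1 := by rw [← mul_pow]; norm_num
  have h6 : ((2 ^ (m + 2) : ℕ) : ℝ) = 4 * 2 ^ m := by push_cast; ring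
  rw [h4, hS, h6] at h3
  rw [hcard, h6, Fintype.card_fin] at h2
  have h7 : (16 : ℝ) ≤ prob (m := m) f (fun A b => 1 ≤ survivors S A b) *
      ((4 * 2 ^ m * (Real.exp (n * Real.exp (-(2 / 5 * f * m))) + B * Real.exp (-(3 / 5 * m)))
        + (4 * 2 ^ m) ^ 2 * (Real.exp (m * Real.exp (-(2 * f * d))) * (1 / 2) ^ m))
          * (1 / 2) ^ m) := by
    refine le_trans (le_of_eq ?_) (h3.trans (mul_le_mul_of_nonneg_left
      (mul_le_mul_of_nonneg_right (hle.trans h2) (by positivity)) hp))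
    rw [mul_assoc, h5]
    norm_num
  have h8 : (4 * 2 ^ m * (Real.exp (n * Real.exp (-(2 / 5 * f * m)))
        + B * Real.exp (-(3 / 5 * m)))
        + (4 * 2 ^ m) ^ 2 * (Real.exp (m * Real.exp (-(2 * f * d))) * (1 / 2) ^ m)) * (1 / 2) ^ m
      = 4 * (Real.exp (n * Real.exp (-(2 / 5 * f * m))) + B * Real.exp (-(3 / 5 * m)))
          * ((2 : ℝ) ^ m * (1 / 2) ^ m)
        + 16 * Real.exp (m * Real.exp (-(2 * f * d))) * ((2 : ℝ) ^ m * (1 / 2) ^ m) ^ 2 := by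
    ring
  rw [h8, h5] at h7
  linarith

open scoped symmDiff in
theorem mem_admissible {ε : ℝ} {m n : ℕ} {f : ℝ} (h0 : 0 ≤ f) (h1 : f ≤ 1 / 2) (d : ℕ) {B : ℝ}
    (hB0 : 0 ≤ B)
    (hB : ∀ ℬ : Finset (Finset (Fin n)), IsLowerSet (ℬ : Set (Finset (Fin n))) →
      ℬ.card = 2 ^ (m + 2) →
      ∑ s ∈ ℬ, ((ℬ.filter fun t => (s ∆ t).card ≤ d).card : ℝ) ≤ ℬ.card * B)
    (hQ : (1 / 2 + ε) * ((Real.exp (n * Real.exp (-(2 / 5 * f * m)))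
      + B * Real.exp (-(3 / 5 * m))) / 4 + Real.exp (m * Real.exp (-(2 * f * d)))) ≤ 1) :
    f ∈ admissible ε m n := by
  refine ⟨h0, h1, fun c hc S hS => ?_⟩
  -- Shattering passes to supersets, so only c = 2 matters.
  obtain ⟨T, hTS, hT⟩ := Finset.exists_subset_card_eq (s := S) (n := 2 ^ (m + 2))
    (by rw [hS]; exact Nat.pow_le_pow_right (by norm_num) (by omega))
  have h2 := hQ.trans (one_le_prob_mul h0 h1 d hB hT)
  refine (le_of_mul_le_mul_right h2 (by positivity)).trans ?_
  refine prob_mono h0 (by linarith) fun A b h => h.trans ?_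
  exact Finset.card_le_card (Finset.filter_subset_filter _ hTS)

/-! ### Asymptotics of the lower bound -/

open Filter Topology

theorem two_le_mul_one_sub_pow {m : ℕ} {f : ℝ} (hm : 0 < m) (hf : f < 1)
    (h : 1 ≤ Real.log m - ((m + 2 : ℕ) : ℝ) * (f / (1 - f))) :
    2 ≤ (m : ℝ) * (1 - f) ^ (m + 2) := by
  have h1 : Real.exp (-(f / (1 - f))) ≤ 1 - f := by
    have h2 : 0 < 1 - f := by linarith
    rw [Real.exp_neg]
    refine inv_le_of_inv_le₀ h2 ?_
    have h3 : (1 - f)⁻¹ = f / (1 - f) + 1 := by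
      field_simp
      ring
    rw [h3]
    exact Real.add_one_le_exp _
  have h4 : Real.exp (Real.log m - ((m + 2 : ℕ) : ℝ) * (f / (1 - f)))
      = m * Real.exp (-(f / (1 - f))) ^ (m + 2) := by
    rw [sub_eq_add_neg, Real.exp_add, Real.exp_log (by exact_mod_cast hm), ← Real.exp_nat_mul,
      mul_neg]
  calc (2 : ℝ) ≤ Real.exp 1 := by linarith [Real.exp_one_gt_d9]
    _ ≤ m * Real.exp (-(f / (1 - f))) ^ (m + 2) := h4 ▸ Real.exp_le_exp.2 h
    _ ≤ _ := by gcongr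

theorem tendsto_log_natCast_div : Tendsto (fun m : ℕ => Real.log m / m) atTop (𝓝 0) := by
  have := (Real.isLittleO_log_id_atTop.tendsto_div_nhds_zero).comp tendsto_natCast_atTop_atTop
  exact this

theorem tendsto_log_natCast : Tendsto (fun m : ℕ => Real.log m) atTop atTop :=
  Real.tendsto_log_atTop.comp tendsto_natCast_atTop_atTop

theorem eventually_lt_minDensity {κ : ℝ} (hκ : 1 < κ) : ∀ᶠ m : ℕ in atTop, ∀ ε : ℝ, 0 < ε →
    ∀ n : ℕ, m + 2 ≤ n → ((Real.log m / (κ * m) : ℝ) : EReal) < minDensity ε m n := by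
  have hf : Tendsto (fun m : ℕ => Real.log m / (κ * m)) atTop (𝓝 0) := by
    have := tendsto_log_natCast_div.const_mul κ⁻¹
    rw [mul_zero] at this
    refine this.congr fun m => ?_
    rw [mul_comm κ, ← div_div, div_eq_mul_inv (Real.log m / m), mul_comm]
  have hinv : Tendsto (fun m : ℕ => (m : ℝ)⁻¹) atTop (𝓝 0) := tendsto_inv_atTop_nhds_zero_nat
  -- With f = log m/(κm), the exponent log m - (m+2) f/(1-f) is log m times this factor, whose limit
  -- 1 - 1/κ is positive.
  have hfac : Tendsto (fun m : ℕ => 1 - (1 + 2 * (m : ℝ)⁻¹) * κ⁻¹ / (1 - Real.log m / (κ * m)))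
      atTop (𝓝 (1 - (1 + 2 * 0) * κ⁻¹ / (1 - 0))) := by
    refine tendsto_const_nhds.sub (Tendsto.div ?_ (tendsto_const_nhds.sub hf) (by norm_num))
    exact (tendsto_const_nhds.add (hinv.const_mul 2)).mul_const _
  have hpos : 0 < 1 - (1 + 2 * 0) * κ⁻¹ / (1 - 0) := by
    have := inv_lt_one_of_one_lt₀ hκ
    simp only [mul_zero, add_zero, one_mul, sub_zero, div_one]
    linarith
  have hmain := tendsto_log_natCast.atTop_mul_pos hpos hfac
  filter_upwards [hmain.eventually_ge_atTop 1, hf.eventually_lt_const (show (0 : ℝ) < 1 by norm_num),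
    eventually_gt_atTop 0] with m h1 h2 hm ε hε n hn
  have hm' : (0 : ℝ) < m := by exact_mod_cast hm
  have hκ0 : κ ≠ 0 := by positivity
  have h3 : 2 ≤ (m : ℝ) * (1 - Real.log m / (κ * m)) ^ (m + 2) := by
    refine two_le_mul_one_sub_pow hm h2 (h1.trans (le_of_eq ?_))
    have h4 : (1 - Real.log m / (κ * m)) ≠ 0 := by linarith
    push_cast
    rw [mul_sub, mul_one]
    congr 1
    rw [← mul_div_assoc, ← mul_div_assoc]
    congr 1
    field_simp
  have key : ∀ f ∈ admissible ε m n, Real.log m / (κ * m) < f := by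
    intro f hfa
    by_contra! hle
    obtain ⟨h0, hhalf, hsh⟩ := hfa
    have h5 := hsh 2 le_rfl (subcube n (m + 2)) (card_subcube hn)
    have h6 := h5.trans (prob_survivors_subcube_le hn h0 (by linarith))
    have h7 : (1 - Real.log m / (κ * m)) ^ (m + 2) ≤ (1 - f) ^ (m + 2) :=
      pow_le_pow_left₀ (by linarith) (by linarith) _
    have h8 : (1 - f) ^ (m + 2) ≤ 1 := pow_le_one₀ (by linarith) (by linarith)
    have h9 : (1 - (1 - f) ^ (m + 2) / 2) ^ m ≤ Real.exp (-1) := by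
      calc _ ≤ Real.exp (-((1 - f) ^ (m + 2) / 2)) ^ m :=
            pow_le_pow_left₀ (by linarith) (by
              linarith [Real.add_one_le_exp (-((1 - f) ^ (m + 2) / 2))]) _
        _ ≤ Real.exp (-1) := by
            rw [← Real.exp_nat_mul]
            refine Real.exp_le_exp.2 ?_
            nlinarith
    have h10 : Real.exp (-1) ≤ 1 / 2 := by
      rw [Real.exp_neg, one_div]
      exact inv_anti₀ (by norm_num) (by linarith [Real.exp_one_gt_d9])
    linarith
  -- The strict inequality survives the infimum because a nonempty admissible set attains it;
  -- otherwise the value is `⊤`.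
  by_cases hne : (admissible ε m n).Nonempty
  · obtain ⟨f, hfl, hfe⟩ := exists_isLeast_admissible hne
    rw [hfe]
    exact EReal.coe_lt_coe_iff.2 (key f hfl.1)
  · rw [Set.not_nonempty_iff_eq_empty] at hne
    rw [minDensity, hne, Set.image_empty, sInf_empty]
    exact EReal.coe_lt_top _

/-! ### A criterion for upper bounds, and limits along rounded values -/

theorem minDensity_le {ε : ℝ} {m n : ℕ} {f : ℝ} (h : f ∈ admissible ε m n) :
    minDensity ε m n ≤ f :=
  sInf_le ⟨f, h, rfl⟩

open scoped symmDiff in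
-- When the three error terms vanish, the normalized second moment bound tends to 1/4 + 1 = 5/4, and
-- (1/2 + ε) · 5/4 < 1 is exactly ε < 3/10.
theorem eventually_mem_admissible {ι : Type*} {l : Filter ι} {m n d : ι → ℕ} {f B : ι → ℝ}
    {ε : ℝ} (hε : ε < 3 / 10) (h0 : ∀ᶠ i in l, 0 ≤ f i) (hf : Tendsto f l (𝓝 0))
    (hB0 : ∀ i, 0 ≤ B i)
    (hB : ∀ᶠ i in l, ∀ ℬ : Finset (Finset (Fin (n i))), IsLowerSet (ℬ : Set (Finset (Fin (n i)))) →
      ℬ.card = 2 ^ (m i + 2) →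
      ∑ s ∈ ℬ, ((ℬ.filter fun t => (s ∆ t).card ≤ d i).card : ℝ) ≤ ℬ.card * B i)
    (h1 : Tendsto (fun i => (n i : ℝ) * Real.exp (-(2 / 5 * f i * m i))) l (𝓝 0))
    (h2 : Tendsto (fun i => B i * Real.exp (-(3 / 5 * m i))) l (𝓝 0))
    (h3 : Tendsto (fun i => (m i : ℝ) * Real.exp (-(2 * f i * d i))) l (𝓝 0)) :
    ∀ᶠ i in l, f i ∈ admissible ε (m i) (n i) := by
  have hQ : Tendsto (fun i => (1 / 2 + ε) *
      ((Real.exp (n i * Real.exp (-(2 / 5 * f i * m i))) + B i * Real.exp (-(3 / 5 * m i))) / 4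
        + Real.exp (m i * Real.exp (-(2 * f i * d i))))) l
      (𝓝 ((1 / 2 + ε) * ((Real.exp 0 + 0) / 4 + Real.exp 0))) :=
    Tendsto.const_mul _ (((((Real.continuous_exp.tendsto 0).comp h1).add h2).div_const 4).add
      ((Real.continuous_exp.tendsto 0).comp h3))
  have hlt : (1 / 2 + ε) * ((Real.exp 0 + 0) / 4 + Real.exp 0) < 1 := by
    rw [Real.exp_zero]
    linarith
  filter_upwards [h0, hf.eventually_lt_const (show (0 : ℝ) < 1 / 2 by norm_num), hB,
    hQ.eventually_lt_const hlt] with i h4 h5 h6 h7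
  exact mem_admissible h4 h5.le (d i) (hB0 i) h6 h7.le

/-- The filter of pairs `(m, n)` with `n → ∞` and `m` equal to `φ n` up to rounding. -/
def roundingFilter (φ : ℕ → ℝ) : Filter (ℕ × ℕ) :=
  comap Prod.snd atTop ⊓ 𝓟 {p | |(p.1 : ℝ) - φ p.2| < 1}

theorem exists_of_eventually_roundingFilter {φ : ℕ → ℝ} {P : ℕ × ℕ → Prop}
    (h : ∀ᶠ p in roundingFilter φ, P p) :
    ∃ N : ℕ, ∀ m n : ℕ, N ≤ n → |(m : ℝ) - φ n| < 1 → P (m, n) := by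
  rw [roundingFilter, eventually_inf_principal, eventually_comap, eventually_atTop] at h
  obtain ⟨N, hN⟩ := h
  exact ⟨N, fun m n hn hm => hN n hn (m, n) rfl hm⟩

section RoundingFilter

variable {φ : ℕ → ℝ}

theorem tendsto_snd_roundingFilter : Tendsto Prod.snd (roundingFilter φ) atTop :=
  tendsto_comap.mono_left inf_le_left

theorem tendsto_snd_cast_roundingFilter :
    Tendsto (fun p : ℕ × ℕ => (p.2 : ℝ)) (roundingFilter φ) atTop :=
  tendsto_natCast_atTop_atTop.comp tendsto_snd_roundingFilter

theorem eventually_abs_sub_lt_roundingFilter :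
    ∀ᶠ p in roundingFilter φ, |(p.1 : ℝ) - φ p.2| < 1 := by
  rw [roundingFilter, eventually_inf_principal]
  exact Eventually.of_forall fun p h => h

theorem tendsto_fst_cast_roundingFilter (hφ : Tendsto φ atTop atTop) :
    Tendsto (fun p : ℕ × ℕ => (p.1 : ℝ)) (roundingFilter φ) atTop := by
  refine tendsto_atTop_mono' _ ?_
    (tendsto_atTop_add_const_right _ (-1) (hφ.comp tendsto_snd_roundingFilter))
  filter_upwards [eventually_abs_sub_lt_roundingFilter] with p hp
  have := abs_lt.1 hp
  simp only [Function.comp]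
  linarith

theorem tendsto_fst_div_roundingFilter {ψ : ℕ → ℝ} {α : ℝ} (hψ : Tendsto ψ atTop atTop)
    (hφ : ∀ n, φ n = α * ψ n) :
    Tendsto (fun p : ℕ × ℕ => (p.1 : ℝ) / ψ p.2) (roundingFilter φ) (𝓝 α) := by
  have h := hψ.comp (tendsto_snd_roundingFilter (φ := φ))
  rw [tendsto_iff_norm_sub_tendsto_zero]
  refine squeeze_zero' (Eventually.of_forall fun p => norm_nonneg _) ?_
    (tendsto_inv_atTop_zero.comp h)
  filter_upwards [eventually_abs_sub_lt_roundingFilter, h.eventually_gt_atTop 0] with p hp hpos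
  simp only [Function.comp] at hpos ⊢
  rw [hφ] at hp
  have : (p.1 : ℝ) / ψ p.2 - α = (p.1 - α * ψ p.2) * (ψ p.2)⁻¹ := by
    field_simp
  rw [this, norm_mul, Real.norm_eq_abs, Real.norm_eq_abs, abs_of_pos (inv_pos.2 hpos)]
  exact mul_le_of_le_one_left (inv_pos.2 hpos).le hp.le

end RoundingFilter

theorem tendsto_log_div_id : Tendsto (fun x : ℝ => Real.log x / x) atTop (𝓝 0) :=
  Real.isLittleO_log_id_atTop.tendsto_div_nhds_zero

theorem tendsto_log_sq_div_id : Tendsto (fun x : ℝ => Real.log x ^ 2 / x) atTop (𝓝 0) :=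
  (Real.isLittleO_pow_log_id_atTop (n := 2)).tendsto_div_nhds_zero

/-! ### The regime m ~ αn -/

/-- The cutoff is d ≈ lam · n. The bound α < 2 C lam makes m exp(-2fd) vanish; the last bound makes
the Hamming ball smaller than exp(3m/5). The choice of `lam` satisfies the former with a little
room, and log 7 ≤ 2 with log(1+y) ≤ y then gives the latter. -/
theorem linear_radius_bounds {α : ℝ} (h0 : 0 < α) (h1 : α < 1) {C lam : ℝ}
    (hC : C = 3.6 - 5 / 4 * Real.logb 2 α) (hlam : lam = α / (2 * C - 1 / 5)) :
    3.6 ≤ C ∧ 0 < lam ∧ lam ≤ 1 ∧ α < 2 * C * lam ∧ lam * (1 - Real.log lam) < 3 / 5 * α := by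
  obtain ⟨l, hl⟩ : ∃ l, l = -Real.logb 2 α := ⟨_, rfl⟩
  have hl0 : 0 < l := by
    rw [hl]
    exact neg_pos.2 (Real.logb_neg (by norm_num) h0 h1)
  have hC' : C = 3.6 + 5 / 4 * l := by rw [hC, hl]; ring
  have hK : 2 * C - 1 / 5 = 7 + 5 / 2 * l := by rw [hC']; norm_num; ring
  rw [hK] at hlam
  have hK0 : 0 < 7 + 5 / 2 * l := by linarith
  have hlam0 : 0 < lam := hlam ▸ div_pos h0 hK0
  have hmul : lam * (7 + 5 / 2 * l) = α := by rw [hlam]; field_simp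
  refine ⟨by linarith, hlam0, by nlinarith, by nlinarith, ?_⟩
  have hlogα : Real.log α = -(l * Real.log 2) := by
    rw [hl, Real.logb]
    have : Real.log 2 ≠ 0 := (Real.log_pos (by norm_num)).ne'
    field_simp
  have hlogK : Real.log (7 + 5 / 2 * l) ≤ 2 + (5 / 2 * l) / 7 := by
    have h7 : Real.log 7 ≤ 2 := by
      rw [Real.log_le_iff_le_exp (by norm_num)]
      calc (7 : ℝ) ≤ 2.71 ^ 2 := by norm_num
        _ ≤ Real.exp 1 ^ 2 := by gcongr; linarith [Real.exp_one_gt_d9]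
        _ = Real.exp 2 := by rw [← Real.exp_nat_mul]; norm_num
    have h8 : 7 + 5 / 2 * l = 7 * (1 + (5 / 2 * l) / 7) := by ring
    rw [h8, Real.log_mul (by norm_num) (by positivity)]
    have := Real.log_le_sub_one_of_pos (show 0 < 1 + (5 / 2 * l) / 7 by positivity)
    linarith
  have hloglam : Real.log lam = Real.log α - Real.log (7 + 5 / 2 * l) := by
    rw [hlam, Real.log_div h0.ne' hK0.ne']
  rw [← hmul]
  have hlt : 1 - Real.log lam < 3 / 5 * (7 + 5 / 2 * l) := by
    rw [hloglam, hlogα]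
    have h2 : l * Real.log 2 ≤ l * 0.6931471808 :=
      mul_le_mul_of_nonneg_left Real.log_two_lt_d9.le hl0.le
    linarith
  nlinarith

open scoped symmDiff in
theorem sum_card_filter_symmDiff_le_exp {n d : ℕ} {D x : ℝ} (hd : (d : ℝ) ≤ D) (hx : 0 < x)
    (hx1 : x ≤ 1) (ℬ : Finset (Finset (Fin n))) :
    ∑ s ∈ ℬ, ((ℬ.filter fun t => (s ∆ t).card ≤ d).card : ℝ)
      ≤ ℬ.card * Real.exp (n * x - D * Real.log x) := by
  rw [← nsmul_eq_mul]
  refine Finset.sum_le_card_nsmul _ _ _ fun s _ => ?_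
  have h := card_powerset_filter_card_le (Finset.univ : Finset (Fin n)) hd hx hx1
  rw [Finset.card_univ, Fintype.card_fin] at h
  exact (Nat.cast_le.2 (card_filter_symmDiff_le ℬ s d)).trans h

theorem minDensity_le_linear {ε α : ℝ} (hε : ε < 3 / 10) (hα0 : 0 < α) (hα1 : α < 1) :
    ∃ N : ℕ, ∀ m n : ℕ, N ≤ n → |(m : ℝ) - α * n| < 1 →
      minDensity ε m n ≤
        (((3.6 - 5 / 4 * Real.logb 2 α) * (Real.log m / m) : ℝ) : EReal) := by
  obtain ⟨C, hC⟩ : ∃ C, C = 3.6 - 5 / 4 * Real.logb 2 α := ⟨_, rfl⟩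
  obtain ⟨lam, hlam⟩ : ∃ lam, lam = α / (2 * C - 1 / 5) := ⟨_, rfl⟩
  obtain ⟨hC1, hlam0, hlam1, hlamC, hent⟩ := linear_radius_bounds hα0 hα1 hC hlam
  rw [← hC]
  suffices h : ∀ᶠ p in roundingFilter (fun n => α * (n : ℝ)),
      C * (Real.log p.1 / p.1) ∈ admissible ε p.1 p.2 by
    obtain ⟨N, hN⟩ := exists_of_eventually_roundingFilter h
    exact ⟨N, fun m n hn hm => minDensity_le (hN m n hn hm)⟩
  have hn := tendsto_snd_cast_roundingFilter (φ := fun n => α * (n : ℝ))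
  have hm := tendsto_fst_cast_roundingFilter (φ := fun n => α * (n : ℝ))
    (tendsto_natCast_atTop_atTop.const_mul_atTop hα0)
  have hmn := tendsto_fst_div_roundingFilter (φ := fun n => α * (n : ℝ))
    tendsto_natCast_atTop_atTop (fun n => rfl)
  have hlog := Real.tendsto_log_atTop.comp hm
  have hm0 := hm.eventually_gt_atTop 0
  have hn0 := hn.eventually_gt_atTop 0
  have hf := (tendsto_log_div_id.comp hm).const_mul C
  rw [mul_zero] at hf
  have hnm := hmn.inv₀ hα0.ne'
  refine eventually_mem_admissible (d := fun p => ⌊lam * p.2⌋₊)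
    (B := fun p => Real.exp (p.2 * lam - lam * p.2 * Real.log lam)) hε ?_ hf
    (fun p => (Real.exp_pos _).le) (Eventually.of_forall fun p ℬ _ _ =>
      sum_card_filter_symmDiff_le_exp (Nat.floor_le (by positivity)) hlam0 hlam1 ℬ) ?_ ?_ ?_
  · filter_upwards [hlog.eventually_ge_atTop 0, hm0] with p h1 h2
    exact mul_nonneg (by linarith) (div_nonneg h1 h2.le)
  -- Here n q is about m^(1 - 2C/5)/α, which vanishes because C ≥ 3.6 > 5/2.
  · have h1 : Tendsto (fun p : ℕ × ℕ => Real.exp (Real.log p.1 * (1 - 2 / 5 * C)))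
        (roundingFilter fun n => α * (n : ℝ)) (𝓝 0) :=
      Real.tendsto_exp_atBot.comp (hlog.atTop_mul_const_of_neg (by linarith))
    have h2 := hnm.mul h1
    rw [mul_zero] at h2
    refine h2.congr' ?_
    filter_upwards [hm0, hn0] with p h3 h4
    have h5 : Real.exp (Real.log p.1 * (1 - 2 / 5 * C))
        = p.1 * Real.exp (-(2 / 5 * (C * (Real.log p.1 / p.1)) * p.1)) := by
      rw [mul_sub, mul_one, sub_eq_add_neg, Real.exp_add, Real.exp_log h3]
      congr 3
      field_simp
    rw [h5, inv_div]
    field_simp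
  · have h1 : Tendsto (fun p : ℕ × ℕ => (p.2 : ℝ) *
        (lam * (1 - Real.log lam) - 3 / 5 * ((p.1 : ℝ) / p.2)))
        (roundingFilter fun n => α * (n : ℝ)) atBot :=
      hn.atTop_mul_neg (by linarith) (tendsto_const_nhds.sub (hmn.const_mul (3 / 5)))
    refine (Real.tendsto_exp_atBot.comp h1).congr' ?_
    filter_upwards [hn0] with p h4
    simp only [Function.comp]
    rw [← Real.exp_add]
    congr 1
    field_simp
    ring
  · have h1 : Tendsto (fun p : ℕ × ℕ => Real.log p.1 *
        (1 - 2 * C * (lam * ((p.1 : ℝ) / p.2)⁻¹ - (p.1 : ℝ)⁻¹)))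
        (roundingFilter fun n => α * (n : ℝ)) atBot := by
      refine hlog.atTop_mul_neg (C := 1 - 2 * C * (lam * α⁻¹ - 0)) ?_ ?_
      · have : 1 < 2 * C * lam * α⁻¹ := by
          rw [← div_eq_mul_inv, one_lt_div hα0]
          exact hlamC
        linarith
      · exact tendsto_const_nhds.sub (((hnm.const_mul lam).sub
          (tendsto_inv_atTop_zero.comp hm)).const_mul (2 * C))
    refine squeeze_zero' (Eventually.of_forall fun p => by positivity) ?_
      (Real.tendsto_exp_atBot.comp h1)
    filter_upwards [hm0, hn0, hlog.eventually_ge_atTop 0] with p h3 h4 h5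
    simp only [Function.comp] at h5 ⊢
    have h6 : lam * p.2 - 1 ≤ (⌊lam * (p.2 : ℝ)⌋₊ : ℝ) := by
      linarith [Nat.lt_floor_add_one (lam * (p.2 : ℝ))]
    have h7 : 0 ≤ 2 * (C * (Real.log p.1 / p.1)) := by positivity
    calc (p.1 : ℝ) * Real.exp (-(2 * (C * (Real.log p.1 / p.1)) * (⌊lam * (p.2 : ℝ)⌋₊ : ℝ)))
        ≤ p.1 * Real.exp (-(2 * (C * (Real.log p.1 / p.1)) * (lam * p.2 - 1))) := by gcongr
      _ = Real.exp (Real.log p.1) *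
            Real.exp (-(2 * (C * (Real.log p.1 / p.1)) * (lam * p.2 - 1))) := by
          rw [Real.exp_log h3]
      _ = _ := by
          rw [← Real.exp_add]
          congr 1
          field_simp
          ring

/-! ### The regime m ~ αn^β -/

open scoped symmDiff in
-- The first exponential counts s \ t inside `s`, which has at most m + 2 elements; the second
-- counts t \ s among n points, but only up to size d/2.
theorem sum_card_filter_symmDiff_le_exp_of_isLowerSet {m n d : ℕ} {D x : ℝ} (hd : (d : ℝ) ≤ D)
    (hx : 0 < x) (hx1 : x ≤ 1) {ℬ : Finset (Finset (Fin n))}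
    (hlow : IsLowerSet (ℬ : Set (Finset (Fin n)))) (hcard : ℬ.card = 2 ^ (m + 2)) :
    ∑ s ∈ ℬ, ((ℬ.filter fun t => (s ∆ t).card ≤ d).card : ℝ)
      ≤ ℬ.card * (2 * (Real.exp ((m + 2) * (1 / 100) - D * Real.log (1 / 100))
        * Real.exp (n * x - D / 2 * Real.log x))) := by
  refine sum_card_filter_symmDiff_le (d := d) (e := d / 2) (by omega) (fun s hs => ?_) ?_
  · refine (card_powerset_filter_card_le s hd (x := 1 / 100) (by norm_num)
      (by norm_num)).trans (Real.exp_le_exp.2 ?_)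
    have h1 : s.card ≤ m + 2 := by
      have := two_pow_card_le_card hlow hs
      rw [hcard] at this
      exact (Nat.pow_le_pow_iff_right (by norm_num)).1 this
    have h2 : (s.card : ℝ) ≤ m + 2 := by exact_mod_cast h1
    linarith
  · have h := card_powerset_filter_card_le (Finset.univ : Finset (Fin n)) (d := d / 2)
      (D := D / 2) (Nat.cast_div_le.trans (by push_cast; linarith)) hx hx1
    rwa [Finset.card_univ, Fintype.card_fin] at h

theorem tendsto_log_div_log_of_tendsto_div_rpow {ι : Type*} {l : Filter ι} {m n : ι → ℝ}
    {α β : ℝ} (hα : 0 < α) (hβ : 0 < β) (hm : Tendsto m l atTop) (hn : Tendsto n l atTop)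
    (hmn : Tendsto (fun i => m i / n i ^ β) l (𝓝 α)) :
    Tendsto (fun i => Real.log (n i) / Real.log (m i)) l (𝓝 β⁻¹) := by
  have hlogn := Real.tendsto_log_atTop.comp hn
  have h1 : Tendsto (fun i => Real.log (m i / n i ^ β) / Real.log (n i) + β) l (𝓝 (0 + β)) :=
    (((Real.continuousAt_log hα.ne').tendsto.comp hmn).div_atTop hlogn).add_const β
  rw [zero_add] at h1
  refine (h1.inv₀ hβ.ne').congr' ?_
  filter_upwards [hm.eventually_gt_atTop 0, hn.eventually_gt_atTop 0,
    hlogn.eventually_gt_atTop 0] with i h2 h3 h4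
  simp only [Function.comp] at h4
  rw [Real.log_div h2.ne' (Real.rpow_pos_of_pos h3 β).ne', Real.log_rpow h3, sub_div,
    mul_div_assoc, div_self h4.ne', mul_one, sub_add_cancel, inv_div]

theorem eventually_div_le_one_of_tendsto_div_rpow {ι : Type*} {l : Filter ι} {m n : ι → ℝ}
    {α β : ℝ} (hβ : β < 1) (hn : Tendsto n l atTop)
    (hmn : Tendsto (fun i => m i / n i ^ β) l (𝓝 α)) : ∀ᶠ i in l, m i / n i ≤ 1 := by
  have h1 : Tendsto (fun i => m i / n i ^ β * n i ^ (-(1 - β))) l (𝓝 (α * 0)) :=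
    hmn.mul ((tendsto_rpow_neg_atTop (sub_pos.2 hβ)).comp hn)
  rw [mul_zero] at h1
  filter_upwards [h1.eventually_le_const (show (0 : ℝ) < 1 by norm_num),
    hn.eventually_gt_atTop 0] with i h2 h3
  refine le_trans (le_of_eq ?_) h2
  rw [neg_sub, Real.rpow_sub h3, Real.rpow_one, div_mul_div_cancel₀]
  exact (Real.rpow_pos_of_pos h3 β).ne'

theorem minDensity_le_sublinear {ε α β κ : ℝ} (hε : ε < 3 / 10) (hα : 0 < α) (hβ0 : 0 < β)
    (hβ1 : β < 1) (hκ : 1 < κ) :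
    ∃ N : ℕ, ∀ m n : ℕ, N ≤ n → |(m : ℝ) - α * (n : ℝ) ^ β| < 1 →
      minDensity ε m n ≤ ((κ * (1 - β) / (2 * β) * (Real.log m ^ 2 / m) : ℝ) : EReal) := by
  obtain ⟨C, hC⟩ : ∃ C, C = κ * (1 - β) / (2 * β) := ⟨_, rfl⟩
  have hβ' : 0 < 1 - β := by linarith
  have hC0 : 0 < C := by rw [hC]; positivity
  rw [← hC]
  set l := roundingFilter (fun n => α * (n : ℝ) ^ β) with hl
  suffices h : ∀ᶠ p in l, C * (Real.log p.1 ^ 2 / p.1) ∈ admissible ε p.1 p.2 by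
    obtain ⟨N, hN⟩ := exists_of_eventually_roundingFilter h
    exact ⟨N, fun m n hn hm => minDensity_le (hN m n hn hm)⟩
  have hpow : Tendsto (fun n : ℕ => (n : ℝ) ^ β) atTop atTop :=
    (tendsto_rpow_atTop hβ0).comp tendsto_natCast_atTop_atTop
  have hn : Tendsto (fun p : ℕ × ℕ => (p.2 : ℝ)) l atTop := tendsto_snd_cast_roundingFilter
  have hm : Tendsto (fun p : ℕ × ℕ => (p.1 : ℝ)) l atTop :=
    tendsto_fst_cast_roundingFilter (hpow.const_mul_atTop hα)
  have hmn : Tendsto (fun p : ℕ × ℕ => (p.1 : ℝ) / (p.2 : ℝ) ^ β) l (𝓝 α) :=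
    tendsto_fst_div_roundingFilter (ψ := fun n => (n : ℝ) ^ β) hpow (fun n => rfl)
  have hlog : Tendsto (fun p : ℕ × ℕ => Real.log p.1) l atTop := Real.tendsto_log_atTop.comp hm
  have hlogn : Tendsto (fun p : ℕ × ℕ => Real.log p.2) l atTop := Real.tendsto_log_atTop.comp hn
  have hm0 := hm.eventually_gt_atTop 0
  have hn0 := hn.eventually_gt_atTop 0
  have hlog0 := hlog.eventually_gt_atTop 0
  have hf : Tendsto (fun p : ℕ × ℕ => C * (Real.log p.1 ^ 2 / p.1)) l (𝓝 0) := by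
    have := (tendsto_log_sq_div_id.comp hm).const_mul C
    rwa [mul_zero] at this
  have hratio : Tendsto (fun p : ℕ × ℕ => Real.log p.2 / Real.log p.1) l (𝓝 β⁻¹) :=
    tendsto_log_div_log_of_tendsto_div_rpow hα hβ0 hm hn hmn
  have hle : ∀ᶠ p in l, (p.1 : ℝ) / p.2 ≤ 1 := eventually_div_le_one_of_tendsto_div_rpow hβ1 hn hmn
  -- The cutoff is d ≈ D = a m/log m. Taking 2Ca = 11/10 > 1 gives 2fD = (11/10) log m, so m
  -- exp(-2fd) vanishes, while `a` stays small enough for B.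
  obtain ⟨a, ha⟩ : ∃ a, a = 11 / 20 / C := ⟨_, rfl⟩
  have ha0 : 0 < a := by rw [ha]; positivity
  have haC : 2 * C * a = 11 / 10 := by rw [ha]; field_simp; norm_num
  have hD0 : ∀ᶠ p in l, 0 ≤ a * ((p.1 : ℝ) / Real.log p.1) := by
    filter_upwards [hm0, hlog0] with p h1 h2
    positivity
  refine eventually_mem_admissible (m := Prod.fst) (n := Prod.snd)
    (f := fun p => C * (Real.log p.1 ^ 2 / p.1)) (d := fun p => ⌊a * ((p.1 : ℝ) / Real.log p.1)⌋₊)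
    (B := fun p => 2 * (Real.exp ((p.1 + 2) * (1 / 100)
        - a * ((p.1 : ℝ) / Real.log p.1) * Real.log (1 / 100))
      * Real.exp (p.2 * (1 / 100 * ((p.1 : ℝ) / p.2))
        - a * ((p.1 : ℝ) / Real.log p.1) / 2 * Real.log (1 / 100 * ((p.1 : ℝ) / p.2)))))
    hε ?_ hf (fun p => by positivity) ?_ ?_ ?_ ?_
  · filter_upwards [hm0] with p h1
    positivity
  · filter_upwards [hD0, hm0, hn0, hle] with p h1 h2 h3 h4 ℬ hlow hcard
    exact sum_card_filter_symmDiff_le_exp_of_isLowerSet (Nat.floor_le h1) (by positivity)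
      (by linarith) hlow hcard
  -- Here fm = C log² m outweighs log n ~ β⁻¹ log m.
  · have h1 : Tendsto (fun p : ℕ × ℕ => Real.log p.1 *
        (Real.log p.2 / Real.log p.1 + -(2 / 5 * C * Real.log p.1))) l atBot :=
      hlog.atTop_mul_atBot₀ (hratio.add_atBot (tendsto_neg_atTop_atBot.comp
        (hlog.const_mul_atTop (by positivity))))
    refine (Real.tendsto_exp_atBot.comp h1).congr' ?_
    filter_upwards [hm0, hn0, hlog0] with p h2 h3 h4
    simp only [Function.comp]
    conv_rhs => rw [← Real.exp_log h3]
    rw [← Real.exp_add]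
    congr 1
    field_simp
  -- The constant is 29/50 = 3/5 - 1/100 - 1/100, the two losses coming from the two counts. The
  -- main term (D/2) log(n/m) is about (a/2)(β⁻¹ - 1) m = (11/20)(m/κ), and 11/20 < 29/50.
  · have h1 : Tendsto (fun p : ℕ × ℕ => (p.1 : ℝ) *
        (-(29 / 50) + 1 / 50 * (p.1 : ℝ)⁻¹
          - 3 / 2 * a * Real.log (1 / 100) * (Real.log p.1)⁻¹
          + a / 2 * (Real.log p.2 / Real.log p.1 - 1))) l atBot := by
      refine hm.atTop_mul_neg (C := -(29 / 50) + 1 / 50 * 0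
          - 3 / 2 * a * Real.log (1 / 100) * 0 + a / 2 * (β⁻¹ - 1)) ?_ ?_
      · have h2 : a / 2 * (β⁻¹ - 1) = 11 / 20 / κ := by
          rw [ha, hC]
          field_simp
        have h3 : 11 / 20 / κ < 11 / 20 := div_lt_self (by norm_num) hκ
        rw [h2]
        linarith
      · exact ((tendsto_const_nhds.add ((tendsto_inv_atTop_zero.comp hm).const_mul _)).sub
          ((tendsto_inv_atTop_zero.comp hlog).const_mul _)).add
          ((hratio.sub_const 1).const_mul _)
    have h2 := (Real.tendsto_exp_atBot.comp h1).const_mul 2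
    rw [mul_zero] at h2
    refine h2.congr' ?_
    filter_upwards [hm0, hn0, hlog0] with p h3 h4 h5
    simp only [Function.comp]
    rw [mul_assoc 2 (Real.exp _ * Real.exp _), ← Real.exp_add, ← Real.exp_add,
      Real.log_mul (by norm_num) (div_pos h3 h4).ne', Real.log_div h3.ne' h4.ne']
    congr 2
    field_simp
    ring
  · have h1 : Tendsto (fun p : ℕ × ℕ =>
        2 * (C * (Real.log p.1 ^ 2 / p.1)) + Real.log p.1 * (-(1 / 10))) l atBot :=
      (hf.const_mul 2).add_atBot (hlog.atTop_mul_const_of_neg (by norm_num))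
    refine squeeze_zero' (Eventually.of_forall fun p => by positivity) ?_
      (Real.tendsto_exp_atBot.comp h1)
    filter_upwards [hm0, hlog0] with p h3 h4
    have h6 : a * ((p.1 : ℝ) / Real.log p.1) - 1
        ≤ (⌊a * ((p.1 : ℝ) / Real.log p.1)⌋₊ : ℝ) := by
      linarith [Nat.lt_floor_add_one (a * ((p.1 : ℝ) / Real.log p.1))]
    have h7 : 0 ≤ 2 * (C * (Real.log p.1 ^ 2 / p.1)) := by positivity
    calc (p.1 : ℝ) * Real.exp (-(2 * (C * (Real.log p.1 ^ 2 / p.1))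
          * (⌊a * ((p.1 : ℝ) / Real.log p.1)⌋₊ : ℝ)))
        ≤ p.1 * Real.exp (-(2 * (C * (Real.log p.1 ^ 2 / p.1))
          * (a * ((p.1 : ℝ) / Real.log p.1) - 1))) := by gcongr
      _ = Real.exp (Real.log p.1) * Real.exp (-(2 * (C * (Real.log p.1 ^ 2 / p.1))
          * (a * ((p.1 : ℝ) / Real.log p.1) - 1))) := by rw [Real.exp_log h3]
      _ = _ := by
          rw [← Real.exp_add]
          simp only [Function.comp]
          congr 1
          have h8 : 2 * (C * (Real.log p.1 ^ 2 / p.1)) * (a * ((p.1 : ℝ) / Real.log p.1))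
              = 11 / 10 * Real.log p.1 := by
            rw [← haC]
            field_simp
          rw [mul_sub, h8]
          ring

end SparseHash

theorem mainTheorem1 :
    (∀ κ : ℝ, 1 < κ → ∃ M : ℕ, ∀ ε : ℝ, 0 < ε → ∀ m n : ℕ, M ≤ m → m + 2 ≤ n →
      ((Real.log m / (κ * m) : ℝ) : EReal) < SparseHash.minDensity ε m n) ∧
    (∀ ε α : ℝ, 0 < ε → ε < 3 / 10 → 0 < α → α < 1 →
      ∃ N : ℕ, ∀ m n : ℕ, N ≤ n → |(m : ℝ) - α * n| < 1 →
        SparseHash.minDensity ε m n ≤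
          (((3.6 - 5 / 4 * Real.logb 2 α) * (Real.log m / m) : ℝ) : EReal)) ∧
    (∀ ε α β κ : ℝ, 0 < ε → ε < 3 / 10 → 0 < α → 0 < β → β < 1 → 1 < κ →
      ∃ N : ℕ, ∀ m n : ℕ, N ≤ n → |(m : ℝ) - α * (n : ℝ) ^ β| < 1 →
        SparseHash.minDensity ε m n ≤
          ((κ * (1 - β) / (2 * β) * (Real.log m ^ 2 / m) : ℝ) : EReal)) := by
  refine ⟨fun κ hκ => ?_, fun ε α _ hε hα0 hα1 => SparseHash.minDensity_le_linear hε hα0 hα1,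
    fun ε α β κ _ hε hα hβ0 hβ1 hκ =>
      SparseHash.minDensity_le_sublinear hε hα hβ0 hβ1 hκ⟩
  obtain ⟨M, hM⟩ := Filter.eventually_atTop.1 (SparseHash.eventually_lt_minDensity hκ)
  exact ⟨M, fun ε hε m n hm hn => hM m hm ε hε n hn⟩
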